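/- Let $p$ and $q$ be coprime integers with $0 < p < q$ and $p + q$ odd. A $(p,q)$-leaper moves from a square $a$ to any of the squares $a + (\pm p, \pm q)$, $a + (\pm q, \pm p)$. Let $G$ be its leaper graph over the $(p+q)\times(p+q)$ chessboard (squares are vertices, moves are edges). *Frames.* For $0 < m < n$, the $(m,n)$-frame is the $(m+n)\times(m+n)$ chessboard with the central $(n-m)\times(n-m)$ square removed; extending the sides of the central hole divides it into eight sections, one in each of the directions E, NE, N, …, SE. All frames are concentric. Given a set $S$ of squares of the $(m,n)$-frame $F$, define three lifted sets, each of the form $\bigcup_d (S + v_d)\cap H_d$, where $d$ ranges over the eight directions, $H_d$ is the section of the larger frame $H$ in direction $d$, and $v_d$ points in direction $d$: - $f(S)$: $H$ is the $(m, 2m+n)$-frame and the $v_d$ are the moves of a $(0,m+n)$-leaper and of an $(m,m)$-leaper; - $g(S)$: $H$ is the $(n, 2n-m)$-frame and the $v_d$ are the moves of a $(0,n-m)$-leaper and of an $(n,n)$-leaper; - $h(S)$: $H$ is the $(n, m+2n)$-frame and the $v_d$ are the moves of a $(0,m+n)$-leaper and of an $(n,n)$-leaper. *Shells.* For $m < n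 \le 3m$, the shell of the $(m,n)$-frame is a union of eight square subboards, one placed symmetrically in each section. If $n \le 2m$, they have side $n-m$; four lie in the corners of the board and four are adjacent by side to the central hole. If $2m \le n \le 3m$, they have side $3m-n$; four lie in the middle of the outer sides and four are adjacent by corner to the central hole. *Types.* The type of a cycle of the $(m,n)$-leaper within the $(m+n)\times(m+n)$ chessboard is defined recursively through its set of squares. A cycle contained in the shell has type $1$. If $S$ is the set of squares of a cycle of type $i$ of the $(m,n)$-leaper, then cycles with sets of squares $f(S)$, $g(S)$, $h(S)$ have types $i$, $i+1$, $i+1$, respectively. Write $$[a_1\pm, a_2\pm, \ldots, a_r] = a_1 \pm \cfrac{1}{a_2 \pm \cfrac{1}{\ddots \pm \frac{1}{a_r}}},$$ where each $\pm$ is a fixed sign. Let $$\frac{q}{p} = [c_1\pm, c_2\pm, \ldots, c_k]$$ with all $c_i$ even integers, $c_1 \ge 0$ and $c_2, \ldots, c_k > 0$, and, for $i = 1, \ldots, k$, let $$\frac{l_i}{d_i} = [c_1\pm, 2-, c_2\pm, 2-, \ldots, c_i]$$ in lowest terms with $d_i>0$, where the sign following each $c_j$ is the same as in the expansion of $\frac{q}{p}$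 and the sign following each $2$ is $-$. Then every cycle of $G$ has exactly one type, which is one of $1, \ldots, k$; for each $i = 1, \ldots, k$ there are cycles of type $i$ in $G$; and every cycle of type $i$ has length $4l_i$. -/

import Mathlib

namespace Leaper

/-! ### Boards, leaper graphs and cycles

A square is identified with the integer point at its center.  Only boards of odd side occur, and
they are placed so that the central square is the origin. -/

/-- The `N × N` chessboard (`N` odd) centered at the origin. -/
def board (N : ℕ) : Set (ℤ × ℤ) :=
  {s | |2 * s.1| < (N : ℤ) ∧ |2 * s.2| < (N : ℤ)}

/-- The moves of a `(p, q)`-leaper on the infinite chessboard. -/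
def moveGraph (p q : ℕ) : SimpleGraph (ℤ × ℤ) where
  Adj a b := a ≠ b ∧
    ((|a.1 - b.1| = (p : ℤ) ∧ |a.2 - b.2| = (q : ℤ)) ∨
      (|a.1 - b.1| = (q : ℤ) ∧ |a.2 - b.2| = (p : ℤ)))
  symm := ⟨fun a b h => by
    rw [abs_sub_comm b.1 a.1, abs_sub_comm b.2 a.2]
    exact ⟨h.1.symm, h.2⟩⟩
  loopless := ⟨fun _ h => h.1 rfl⟩

/-- The leaper graph of a `(p, q)`-leaper over the `(p + q) × (p + q)` chessboard. -/
def leaperGraph (p q : ℕ) : SimpleGraph (board (p + q)) :=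
  (moveGraph p q).induce (board (p + q))

/-- The set of squares visited by a walk in the leaper graph. -/
def squares {p q : ℕ} {a b : board (p + q)} (C : (leaperGraph p q).Walk a b) : Set (ℤ × ℤ) :=
  Subtype.val '' {s | s ∈ C.support}

/-- `S` is the vertex set of a cycle of the `(p, q)`-leaper within the `(p + q) × (p + q)` board. -/
def IsCycleSet (p q : ℕ) (S : Set (ℤ × ℤ)) : Prop :=
  ∃ (a : board (p + q)) (C : (leaperGraph p q).Walk a a), C.IsCycle ∧ squares C = S

/-! ### Frames and their sections

The `(p, q)`-frame, `p < q`, is the `(p + q) × (p + q)` board without the central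
`(q - p) × (q - p)` square.  The eight directions E, NE, …, SE are the nonzero vectors of signs:
E is `(1, 0)`, NE is `(1, 1)`, N is `(0, 1)`, and so on. -/

/-- The coordinate `x` lies in the negative, the middle or the positive one of the three bands
into which the sides of the central hole, extended, divide the board. -/
def InBand (p q : ℕ) : SignType → ℤ → Prop
  | .neg, x => -((p : ℤ) + q) < 2 * x ∧ 2 * x < -((q : ℤ) - p)
  | .zero, x => |2 * x| < (q : ℤ) - p
  | .pos, x => (q : ℤ) - p < 2 * x ∧ 2 * x < (p : ℤ) + q

/-- The section of the `(p, q)`-frame in the direction `d`. -/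
def frameSection (p q : ℕ) (d : SignType × SignType) : Set (ℤ × ℤ) :=
  {s | InBand p q d.1 s.1 ∧ InBand p q d.2 s.2}

/-! ### Lifting transformations -/

/-- The translation vector pointing in direction `d` which is a move of a `(0, a)`-leaper if `d` is
E, N, W or S, and a move of a `(b, b)`-leaper if `d` is NE, NW, SW or SE. -/
def dirVector (a b : ℤ) (d : SignType × SignType) : ℤ × ℤ :=
  if d.1 = 0 ∨ d.2 = 0 then (a * (d.1 : ℤ), a * (d.2 : ℤ)) else (b * (d.1 : ℤ), b * (d.2 : ℤ))

/-- The union, over the eight directions `d`, of `(S + v_d) ∩ H_d`, where `H` is the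
`(p, q)`-frame and `v_d = dirVector a b d`. -/
def lift (p q : ℕ) (a b : ℤ) (S : Set (ℤ × ℤ)) : Set (ℤ × ℤ) :=
  {s | ∃ d : SignType × SignType, d ≠ 0 ∧ s ∈ frameSection p q d ∧ s - dirVector a b d ∈ S}

/-- The transformation `f`, from the `(m, n)`-frame to the `(m, 2m + n)`-frame. -/
def liftF (m n : ℕ) (S : Set (ℤ × ℤ)) : Set (ℤ × ℤ) :=
  lift m (2 * m + n) ((m : ℤ) + n) m S

/-- The transformation `g`, from the `(m, n)`-frame (`m < n`) to the `(n, 2n - m)`-frame. -/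
def liftG (m n : ℕ) (S : Set (ℤ × ℤ)) : Set (ℤ × ℤ) :=
  lift n (2 * n - m) ((n : ℤ) - m) n S

/-- The transformation `h`, from the `(m, n)`-frame to the `(n, m + 2n)`-frame. -/
def liftH (m n : ℕ) (S : Set (ℤ × ℤ)) : Set (ℤ × ℤ) :=
  lift n (m + 2 * n) ((m : ℤ) + n) n S

/-! ### Shells -/

/-- One coordinate of a point of the square subboard in a given direction: `|2x| < mid` if the
direction has component `e = 0`, and `lo < 2ex < hi` if it has component `e = ±1`. -/
def InSpan (mid lo hi : ℤ) (e : SignType) (x : ℤ) : Prop :=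
  if e = 0 then |2 * x| < mid else lo < 2 * (e : ℤ) * x ∧ 2 * (e : ℤ) * x < hi

/-- The shell of the `(m, n)`-frame, `m < n ≤ 3m`: the union of eight square subboards, one in each
direction.

If `n ≤ 2m`, their side is `n - m`, four of them lie in the corners of the board and four are
adjacent by side to the central hole.  Otherwise their side is `3m - n`, four of them lie in the
middle of the outer sides and four are adjacent by corner to the central hole. -/
def shell (m n : ℕ) : Set (ℤ × ℤ) :=
  {s | ∃ d : SignType × SignType, d ≠ 0 ∧
    if n ≤ 2 * m then
      if d.1 = 0 ∨ d.2 = 0 then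
        InSpan ((n : ℤ) - m) ((n : ℤ) - m) (3 * ((n : ℤ) - m)) d.1 s.1 ∧
        InSpan ((n : ℤ) - m) ((n : ℤ) - m) (3 * ((n : ℤ) - m)) d.2 s.2
      else
        InSpan ((n : ℤ) - m) ((m : ℤ) + n - 2 * ((n : ℤ) - m)) ((m : ℤ) + n) d.1 s.1 ∧
        InSpan ((n : ℤ) - m) ((m : ℤ) + n - 2 * ((n : ℤ) - m)) ((m : ℤ) + n) d.2 s.2
    else
      if d.1 = 0 ∨ d.2 = 0 then
        InSpan (3 * (m : ℤ) - n) ((m : ℤ) + n - 2 * (3 * (m : ℤ) - n)) ((m : ℤ) + n) d.1 s.1 ∧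
        InSpan (3 * (m : ℤ) - n) ((m : ℤ) + n - 2 * (3 * (m : ℤ) - n)) ((m : ℤ) + n) d.2 s.2
      else
        InSpan (3 * (m : ℤ) - n) ((n : ℤ) - m) ((n : ℤ) - m + 2 * (3 * (m : ℤ) - n)) d.1 s.1 ∧
        InSpan (3 * (m : ℤ) - n) ((n : ℤ) - m) ((n : ℤ) - m + 2 * (3 * (m : ℤ) - n)) d.2 s.2}

/-! ### The type of a cycle -/

/-- `HasType p q i S`: `S` is the set of squares of a cycle of type `i` of the `(p, q)`-leaper.
The cycles within the shell have type `1`; lifting by `f` preserves the type of a cycle and lifting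
by `g` or `h` increases it by one.  (The shell of the `(1, 2)`-frame, with which every sequence of
liftings begins, is the whole frame.) -/
inductive HasType : ℕ → ℕ → ℕ → Set (ℤ × ℤ) → Prop
  | shell (m n : ℕ) (S : Set (ℤ × ℤ)) (hm : 0 < m) (hmn : m < n) (hn : n ≤ 3 * m)
      (hS : IsCycleSet m n S) (hsub : S ⊆ shell m n) : HasType m n 1 S
  | f (m n i : ℕ) (S : Set (ℤ × ℤ)) (hmn : m < n) (hS : HasType m n i S) :
      HasType m (2 * m + n) i (liftF m n S)
  | g (m n i : ℕ) (S : Set (ℤ × ℤ)) (hmn : m < n) (hS : HasType m n i S) :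
      HasType n (2 * n - m) (i + 1) (liftG m n S)
  | h (m n i : ℕ) (S : Set (ℤ × ℤ)) (hmn : m < n) (hS : HasType m n i S) :
      HasType n (m + 2 * n) (i + 1) (liftH m n S)

/-! ### Continued fractions -/

/-- `signedCF [(a₁, s₁), …, (aₙ, sₙ)] b` is `a₁ + s₁ / (a₂ + s₂ / (… + sₙ / b))`, where the signs
`sⱼ` are `1` or `-1`. -/
def signedCF : List (ℤ × ℤˣ) → ℤ → ℚ
  | [], b => b
  | (a, s) :: t, b => a + ((s : ℤ) : ℚ) / signedCF t b

/-- `[c₁±, c₂±, …, c_k]`, where `s i` is the sign following `c i`. -/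
def cfValue (c : ℕ → ℤ) (s : ℕ → ℤˣ) (k : ℕ) : ℚ :=
  signedCF ((List.Ico 1 k).map fun j => (c j, s j)) (c k)

/-- `[c₁±, …, c_k]` is an even continued fraction. -/
def IsEvenCF (c : ℕ → ℤ) (k : ℕ) : Prop :=
  1 ≤ k ∧ (∀ i ∈ Finset.Icc 1 k, Even (c i)) ∧ 0 ≤ c 1 ∧ ∀ i ∈ Finset.Icc 2 k, 0 < c i

/-- `[c₁±, 2-, c₂±, 2-, …, c_i]`, where `s j` is the sign following `c j`. -/
def lengthRatio (c : ℕ → ℤ) (s : ℕ → ℤˣ) (i : ℕ) : ℚ :=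
  signedCF ((List.Ico 1 i).flatMap fun j => [(c j, s j), (2, -1)]) (c i)

end Leaper

/-!
Translating each section of the large frame `H` of a lifting by `-v_d` maps `H` to the smaller
board. The eight vectors `v_d`, taken cyclically so that consecutive ones differ by a leaper move,
form a star octagon, and the squares of `H` over a given square of the smaller board form an arc of
it: the whole octagon over a square of the central hole (for `g` and `h`), and a path otherwise.
Adjacent arcs lie over equal or adjacent squares, so components correspond to components: the cycles
of `H` are the lifted cycles of the smaller frame, together with the octagons over its hole, which
make up the shell of `H`. Hence the Euclidean-like descent `(p, q) ↦ (m, n)` determines the types.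

If a cycle has `4x` squares in the corner sections and `4y` in the side sections, then a lifting
acts on `(x, y)` by a unimodular matrix, starting from `(1, 1)` for an octagon. In terms of
`(x + y) / x` the matrices are `r ↦ r + 2` for `f` and `r ↦ 2 ∓ 1 / (2 - 1 / r)` for `g` and `h`,
while `q / p` is `n / m + 2` and `2 ∓ 1 / (n / m)`. So `(x + y) / x` has the expansion of `q / p`
with a `2-` inserted after each term.
-/

namespace Leaper

/-- The `(p, q)`-frame, as a set of squares. -/
def frame (p q : ℕ) : Set (ℤ × ℤ) :=
  {s | ∃ d : SignType × SignType, d ≠ 0 ∧ s ∈ frameSection p q d}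

/-- The vector in direction `d` of an octagon whose sides are moves of a `(p, q)`-leaper.  It is the
translation used in direction `d` by each of the liftings `f`, `g` and `h` into the
`(p, q)`-frame. -/
def shift (p q : ℕ) (d : SignType × SignType) : ℤ × ℤ := dirVector ((q : ℤ) - p) p d

section Frames

variable {p q : ℕ} {x : ℤ} {δ ε : SignType} {d e : SignType × SignType} {s : ℤ × ℤ}

lemma InBand.unique (hpq : p < q) (hδ : InBand p q δ x) (hε : InBand p q ε x) : δ = ε := by
  cases δ <;> cases ε <;> simp only [InBand, abs_lt] at hδ hε <;> first | rfl | omega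

lemma frameSection_unique (hpq : p < q) (hd : s ∈ frameSection p q d)
    (he : s ∈ frameSection p q e) : d = e :=
  Prod.ext (hd.1.unique hpq he.1) (hd.2.unique hpq he.2)

lemma exists_inBand_iff (hodd : Odd (p + q)) :
    (∃ δ, InBand p q δ x) ↔ |2 * x| < (p : ℤ) + q := by
  obtain ⟨r, hr⟩ := hodd
  rw [abs_lt]
  constructor
  · rintro ⟨δ, hδ⟩
    cases δ <;> simp only [InBand, abs_lt] at hδ <;> omega
  · intro hx
    rcases lt_trichotomy (2 * x) (-((q : ℤ) - p)) with h | h | h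
    · exact ⟨.neg, hx.1, h⟩
    · omega
    · rcases lt_trichotomy (2 * x) ((q : ℤ) - p) with h' | h' | h'
      · exact ⟨.zero, abs_lt.2 ⟨h, h'⟩⟩
      · omega
      · exact ⟨.pos, h', hx.2⟩

lemma mem_board_iff_exists_frameSection (hodd : Odd (p + q)) :
    s ∈ board (p + q) ↔ ∃ d, s ∈ frameSection p q d := by
  simp only [board, Set.mem_ofPred_eq, Nat.cast_add, ← exists_inBand_iff hodd]
  exact ⟨fun ⟨⟨δ, hδ⟩, ε, hε⟩ => ⟨(δ, ε), hδ, hε⟩, fun ⟨d, hd⟩ => ⟨⟨_, hd.1⟩, _, hd.2⟩⟩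

lemma frame_subset_board : frame p q ⊆ board (p + q) := by
  have mem_band : ∀ {δ x}, InBand p q δ x → |2 * x| < ((p + q : ℕ) : ℤ) := by
    intro δ x h
    cases δ <;> simp only [InBand, abs_lt] at h ⊢ <;> omega
  rintro s ⟨d, -, h⟩
  exact ⟨mem_band h.1, mem_band h.2⟩

lemma pos_of_mem_frame (hs : s ∈ frame p q) : 0 < p := by
  obtain ⟨⟨δ, ε⟩, hd, h1, h2⟩ := hs
  cases δ <;> cases ε <;> simp only [InBand] at h1 h2 <;> first | omega | exact absurd rfl hd

end Frames

/-! ### The star octagon -/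

/-- The direction following `d` in the cyclic order
NE, S, NW, E, SW, N, SE, W, in which the vectors `shift p q d` are the successive vertices of an
octagon with sides `(±p, ±q)` and `(±q, ±p)`. -/
noncomputable def next (d : SignType × SignType) : SignType × SignType :=
  (SignType.sign ((d.2 : ℤ) - d.1), -SignType.sign ((d.1 : ℤ) + d.2))

/-- The direction preceding `d` in the cyclic order of `next`. -/
noncomputable def prev (d : SignType × SignType) : SignType × SignType :=
  (-SignType.sign ((d.1 : ℤ) + d.2), SignType.sign ((d.1 : ℤ) - d.2))

/-- The directions `d` and `c` are neighbors in the cyclic order of `next`. -/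
def Consecutive (d c : SignType × SignType) : Prop := c = next d ∨ c = prev d

noncomputable instance : DecidableRel Consecutive := fun _ _ => inferInstanceAs (Decidable (_ ∨ _))

/-- The leaper graph over the `(p + q) × (p + q)` board, with the integer points outside of the
board added as isolated vertices. -/
def boardGraph (p q : ℕ) : SimpleGraph (ℤ × ℤ) := (leaperGraph p q).spanningCoe

section StarOctagon

variable {p q : ℕ} {d : SignType × SignType} {s t : ℤ × ℤ}

lemma boardGraph_adj :
    (boardGraph p q).Adj s t ↔ s ∈ board (p + q) ∧ t ∈ board (p + q) ∧ (moveGraph p q).Adj s t := by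
  simp [boardGraph, leaperGraph, and_left_comm]

lemma leaperGraph_adj_iff {a b : board (p + q)} :
    (leaperGraph p q).Adj a b ↔ (boardGraph p q).Adj a b := by
  simp [boardGraph_adj, leaperGraph]

lemma moveGraph_adj_iff {x y z w : ℤ} (hq : 0 < q) : (moveGraph p q).Adj (x, y) (z, w) ↔
    ((z = x + p ∨ z = x - p) ∧ (w = y + q ∨ w = y - q)) ∨
      ((z = x + q ∨ z = x - q) ∧ (w = y + p ∨ w = y - p)) := by
  have abs_sub_eq {a b : ℤ} {n : ℕ} : |a - b| = (n : ℤ) ↔ b = a + n ∨ b = a - n := by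
    rw [abs_eq (by positivity)]
    omega
  simp only [moveGraph, abs_sub_eq, ne_eq, Prod.mk.injEq]
  omega

lemma boardGraph_adj_iff_consecutive (hpq : p < q) (hd : d ≠ 0) (hs : s ∈ frameSection p q d) :
    (boardGraph p q).Adj s t ↔ ∃ c, Consecutive d c ∧ t = s - shift p q d + shift p q c := by
  have hb : s ∈ board (p + q) := frame_subset_board ⟨d, hd, hs⟩
  obtain ⟨x, y⟩ := s
  obtain ⟨z, w⟩ := t
  obtain ⟨h1, h2⟩ := hs
  rw [boardGraph_adj, and_iff_right hb, moveGraph_adj_iff (by omega)]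
  simp only [board, Set.mem_ofPred_eq, abs_lt, Consecutive, or_and_right, exists_or,
    exists_eq_left]
  fin_cases d <;> first | exact absurd rfl hd | skip
  all_goals
    simp only [InBand, abs_lt] at h1 h2
    simp [next, prev, shift, dirVector]
    omega

lemma mem_frame_of_adj (hpq : p < q) (hodd : Odd (p + q)) (h : (boardGraph p q).Adj s t) :
    s ∈ frame p q := by
  obtain ⟨hs, ht, hst⟩ := boardGraph_adj.1 h
  obtain ⟨d, hd⟩ := (mem_board_iff_exists_frameSection hodd).1 hs
  refine ⟨d, ?_, hd⟩
  rintro rfl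
  obtain ⟨x, y⟩ := s
  obtain ⟨z, w⟩ := t
  obtain ⟨hx, hy⟩ := hd
  rw [moveGraph_adj_iff (by omega)] at hst
  simp only [board, Set.mem_ofPred_eq, abs_lt, Nat.cast_add] at ht
  change |2 * x| < (q : ℤ) - p at hx
  change |2 * y| < (q : ℤ) - p at hy
  rw [abs_lt] at hx hy
  omega

lemma shift_of_side (h : d.1 = 0 ∨ d.2 = 0) :
    shift p q d = (((q : ℤ) - p) * d.1, ((q : ℤ) - p) * d.2) := by
  rw [shift, dirVector, if_pos h]

lemma shift_of_corner (h₁ : d.1 ≠ 0) (h₂ : d.2 ≠ 0) :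
    shift p q d = (p * (d.1 : ℤ), p * (d.2 : ℤ)) := by
  rw [shift, dirVector, if_neg (not_or.2 ⟨h₁, h₂⟩)]

lemma shift_injective (hp : 0 < p) (hpq : p < q) : Function.Injective (shift p q) := by
  intro d e h
  zify at hp hpq
  fin_cases d <;> fin_cases e <;> simp [shift, dirVector] at h ⊢ <;> omega

lemma ncard_neighborSet (hpq : p < q) (hs : s ∈ frame p q) :
    ((boardGraph p q).neighborSet s).ncard = 2 := by
  have hp := pos_of_mem_frame hs
  obtain ⟨d, hd, hs⟩ := hs
  have hcard : ∀ d ≠ 0, (Finset.univ.filter (Consecutive d)).card = 2 := by decide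
  have : (boardGraph p q).neighborSet s =
      (fun c => s - shift p q d + shift p q c) '' (Finset.univ.filter (Consecutive d)) := by
    ext t
    simp [boardGraph_adj_iff_consecutive hpq hd hs, eq_comm]
  rw [this, Set.ncard_image_of_injective, Set.ncard_coe_finset, hcard d hd]
  exact (add_right_injective _).comp (shift_injective hp hpq)

end StarOctagon

/-! ### Cycles as connected components -/

/-- The connected component of `s` in the leaper graph, as a set of squares. -/
def component (p q : ℕ) (s : ℤ × ℤ) : Set (ℤ × ℤ) := {t | (boardGraph p q).Reachable s t}

section Components

variable {p q : ℕ} {s t : ℤ × ℤ}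

lemma self_mem_component (p q : ℕ) (s : ℤ × ℤ) : s ∈ component p q s :=
  SimpleGraph.Reachable.refl s

lemma component_eq_of_mem (h : t ∈ component p q s) : component p q t = component p q s :=
  Set.ext fun _ => ⟨h.trans, h.symm.trans⟩

lemma component_subset {A : Set (ℤ × ℤ)} (hs : s ∈ A)
    (hA : ∀ u v, (boardGraph p q).Adj u v → u ∈ A → v ∈ A) : component p q s ⊆ A := by
  rintro t ⟨w⟩
  induction w with
  | nil => exact hs
  | cons huv _ ih => exact ih (hA _ _ huv hs)

lemma component_subset_frame (hpq : p < q) (hodd : Odd (p + q)) (hs : s ∈ frame p q) :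
    component p q s ⊆ frame p q :=
  component_subset hs fun _ _ huv _ => mem_frame_of_adj hpq hodd huv.symm

lemma finite_board (N : ℕ) : (board N).Finite := by
  refine ((Set.finite_Icc (-(N : ℤ)) N).prod (Set.finite_Icc (-(N : ℤ)) N)).subset ?_
  rintro ⟨x, y⟩ h
  simp only [board, Set.mem_ofPred_eq, abs_lt] at h
  simp only [Set.mem_prod, Set.mem_Icc]
  omega

lemma isCycles_leaperGraph (hpq : p < q) (hodd : Odd (p + q)) : (leaperGraph p q).IsCycles := by
  rintro v ⟨w, hw⟩
  rw [← ncard_neighborSet hpq (mem_frame_of_adj hpq hodd (leaperGraph_adj_iff.1 hw)),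
    ← Set.ncard_image_of_injective _ Subtype.val_injective]
  congr 1
  ext t
  simp only [Set.mem_image, SimpleGraph.mem_neighborSet, leaperGraph_adj_iff]
  exact ⟨fun ⟨_, hu, h⟩ => h ▸ hu, fun h => ⟨⟨t, (boardGraph_adj.1 h).2.1⟩, h, rfl⟩⟩

lemma squares_eq_component (hpq : p < q) (hodd : Odd (p + q)) {a : board (p + q)}
    {C : (leaperGraph p q).Walk a a} (hC : C.IsCycle) : squares C = component p q a := by
  have : Finite (board (p + q)) := finite_board _
  have : (leaperGraph p q).LocallyFinite := fun _ => Fintype.ofFinite _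
  apply Set.Subset.antisymm
  · rintro _ ⟨u, hu, rfl⟩
    exact (C.takeUntil u hu).reachable.map (SimpleGraph.Embedding.spanningCoe _).toHom
  · refine component_subset ⟨a, C.start_mem_support, rfl⟩ ?_
    rintro _ v huv ⟨u, hu, rfl⟩
    have hv := (boardGraph_adj.1 huv).2.1
    have huC := (hC.adj_toSubgraph_iff_of_isCycles (isCycles_leaperGraph hpq hodd)
      (C.mem_verts_toSubgraph.2 hu) ⟨v, hv⟩).2 (leaperGraph_adj_iff.2 huv)
    exact ⟨⟨v, hv⟩, C.mem_verts_toSubgraph.1 huC.snd_mem, rfl⟩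

lemma isCycleSet_component (hpq : p < q) (hodd : Odd (p + q)) (hs : s ∈ frame p q) :
    IsCycleSet p q (component p q s) := by
  have : Finite (board (p + q)) := finite_board _
  have hsb := frame_subset_board hs
  obtain ⟨t, hst⟩ : ((boardGraph p q).neighborSet s).Nonempty :=
    Set.nonempty_of_ncard_ne_zero (ncard_neighborSet hpq hs ▸ two_ne_zero)
  obtain ⟨C, hC, -⟩ :=
    (isCycles_leaperGraph hpq hodd).exists_cycle_toSubgraph_verts_eq_connectedComponentSupp
      (c := (leaperGraph p q).connectedComponentMk ⟨s, hsb⟩) rfl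
      ⟨⟨t, (boardGraph_adj.1 hst).2.1⟩, leaperGraph_adj_iff.2 hst⟩
  exact ⟨_, C, hC, squares_eq_component hpq hodd hC⟩

lemma isCycleSet_iff (hpq : p < q) (hodd : Odd (p + q)) {S : Set (ℤ × ℤ)} :
    IsCycleSet p q S ↔ ∃ s ∈ frame p q, S = component p q s := by
  constructor
  · rintro ⟨a, C, hC, rfl⟩
    refine ⟨a, ?_, squares_eq_component hpq hodd hC⟩
    cases C with
    | nil => exact absurd hC SimpleGraph.Walk.not_isCycle_nil
    | cons h _ => exact mem_frame_of_adj hpq hodd (leaperGraph_adj_iff.1 h)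
  · rintro ⟨s, hs, rfl⟩
    exact isCycleSet_component hpq hodd hs

lemma length_eq_ncard_squares {a : board (p + q)} {C : (leaperGraph p q).Walk a a}
    (hC : C.IsCycle) : C.length = (squares C).ncard := by
  classical
  have hsupp : {s | s ∈ C.support} = C.support.tail.toFinset := by
    ext s
    simp only [Set.mem_ofPred_eq, List.coe_toFinset]
    rw [← C.cons_tail_support, List.mem_cons, List.tail_cons, or_iff_right_of_imp]
    rintro rfl
    exact SimpleGraph.Walk.end_mem_tail_support hC.not_nil
  rw [squares, Set.ncard_image_of_injective _ Subtype.val_injective, hsupp, Set.ncard_coe_finset,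
    List.toFinset_card_of_nodup hC.support_nodup, List.length_tail, C.length_support,
    Nat.add_sub_cancel]

end Components

/-! ### Liftings -/

/-- The three lifting transformations. -/
inductive Lifting
  | f
  | g
  | h
  deriving DecidableEq

namespace Lifting

/-- The lifting `L` maps sets of squares of the `(m, n)`-frame to sets of squares of the
`(p, q)`-frame. The degenerate case `m = 0`, where the `(m, n)`-frame is empty, is included. -/
def Carries (L : Lifting) (m n p q : ℕ) : Prop :=
  m < n ∧ match L with
    | f => p = m ∧ q = 2 * m + n
    | g => p = n ∧ q + m = 2 * n
    | h => p = n ∧ q = m + 2 * n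

/-- A coordinate in the band `ε` of the `(m, n)`-frame reaches the band `η` of the larger frame
when it is translated by the corner vector of sign `η`, or by the side vector of sign `-η`. -/
def Reaches : Lifting → SignType → SignType → Prop
  | f, ε, η => η = 0 ∨ ε = η
  | g, ε, η => ε = 0 ∨ ε = -η
  | h, ε, η => η = 0 ∨ ε = 0 ∨ ε = η

instance (L : Lifting) (ε η : SignType) : Decidable (L.Reaches ε η) := by
  cases L <;> unfold Reaches <;> infer_instance

/-- The directions in which the squares in the section `e` of the smaller board are lifted by `L`;
the section `0` is the central hole. -/
def dirs (L : Lifting) (e : SignType × SignType) : Finset (SignType × SignType) :=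
  {d | d ≠ 0 ∧
    if d.1 = 0 ∨ d.2 = 0 then L.Reaches e.1 (-d.1) ∧ L.Reaches e.2 (-d.2)
    else L.Reaches e.1 d.1 ∧ L.Reaches e.2 d.2}

end Lifting

/-- The square `s` of the `(p, q)`-frame is the translate of the square `u` in the direction of the
section that contains `s`. -/
def LiesOver (p q : ℕ) (s u : ℤ × ℤ) : Prop :=
  ∃ d : SignType × SignType, d ≠ 0 ∧ s ∈ frameSection p q d ∧ s = u + shift p q d

/-- The common form of the liftings `f`, `g` and `h` into the `(p, q)`-frame. -/
def liftTo (p q : ℕ) (S : Set (ℤ × ℤ)) : Set (ℤ × ℤ) := lift p q ((q : ℤ) - p) p S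

section LiftTo

variable {p q m n : ℕ} {s u v : ℤ × ℤ} {S : Set (ℤ × ℤ)}

lemma mem_liftTo : s ∈ liftTo p q S ↔ ∃ u ∈ S, LiesOver p q s u := by
  constructor
  · rintro ⟨d, hd, hs, hu⟩
    exact ⟨_, hu, d, hd, hs, (sub_add_cancel s (shift p q d)).symm⟩
  · rintro ⟨u, hu, d, hd, hs, rfl⟩
    exact ⟨d, hd, hs, (add_sub_cancel_right u (shift p q d)).symm ▸ hu⟩

lemma exists_liesOver (hs : s ∈ frame p q) : ∃ u, LiesOver p q s u := by
  obtain ⟨d, hd, hs⟩ := hs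
  exact ⟨s - shift p q d, d, hd, hs, (sub_add_cancel _ _).symm⟩

lemma LiesOver.mem_frame (h : LiesOver p q s u) : s ∈ frame p q := by
  obtain ⟨d, hd, hs, -⟩ := h
  exact ⟨d, hd, hs⟩

lemma LiesOver.unique (hpq : p < q) (hu : LiesOver p q s u) (hv : LiesOver p q s v) : u = v := by
  obtain ⟨d, -, hd, rfl⟩ := hu
  obtain ⟨e, -, he, huv⟩ := hv
  rw [frameSection_unique hpq hd he] at huv
  exact add_right_cancel huv

lemma liftF_eq_liftTo : liftF m n S = liftTo m (2 * m + n) S := by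
  have : ((m : ℤ) + n) = (2 * m + n : ℕ) - m := by push_cast; ring
  rw [liftF, liftTo, this]

lemma liftG_eq_liftTo (hmn : m < n) : liftG m n S = liftTo n (2 * n - m) S := by
  have : ((n : ℤ) - m) = (2 * n - m : ℕ) - n := by omega
  rw [liftG, liftTo, this]

lemma liftH_eq_liftTo : liftH m n S = liftTo n (m + 2 * n) S := by
  have : ((m : ℤ) + n) = (m + 2 * n : ℕ) - n := by push_cast; ring
  rw [liftH, liftTo, this]

end LiftTo

namespace Lifting.Carries

variable {L : Lifting} {m n p q : ℕ} {s u : ℤ × ℤ} {δ ε : SignType} {z : ℤ}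
  {d e : SignType × SignType}

lemma lt_base (hL : L.Carries m n p q) : m < n := hL.1

lemma lt (hL : L.Carries m n p q) : p < q := by
  cases L <;> obtain ⟨hmn, rfl, hq⟩ := hL <;> omega

lemma odd_iff (hL : L.Carries m n p q) : Odd (p + q) ↔ Odd (m + n) := by
  simp only [Nat.odd_iff]
  cases L <;> obtain ⟨hmn, rfl, hq⟩ := hL <;> omega

lemma inBand_add_corner_iff (hL : L.Carries m n p q) (hz : InBand m n ε z) :
    InBand p q δ (z + p * δ) ↔ L.Reaches ε δ := by
  cases L <;> obtain ⟨hmn, rfl, hq⟩ := hL <;> cases ε <;> simp only [InBand, abs_lt] at hz <;>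
    cases δ <;> simp [Reaches, InBand, abs_lt, -abs_mul] <;> omega

lemma inBand_add_side_iff (hL : L.Carries m n p q) (hz : InBand m n ε z) :
    InBand p q δ (z + ((q : ℤ) - p) * δ) ↔ L.Reaches ε (-δ) := by
  cases L <;> obtain ⟨hmn, rfl, hq⟩ := hL <;> cases ε <;> simp only [InBand, abs_lt] at hz <;>
    cases δ <;> simp [Reaches, InBand, abs_lt, -abs_mul] <;> omega

lemma abs_lt_of_inBand_add_corner (hL : L.Carries m n p q) (hz : InBand p q δ (z + p * δ)) :
    |2 * z| < (m : ℤ) + n := by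
  cases L <;> obtain ⟨hmn, rfl, hq⟩ := hL <;> cases δ <;>
    simp [InBand, abs_lt, -abs_mul] at hz ⊢ <;> omega

lemma abs_lt_of_inBand_add_side (hL : L.Carries m n p q)
    (hz : InBand p q δ (z + ((q : ℤ) - p) * δ)) : |2 * z| < (m : ℤ) + n := by
  cases L <;> obtain ⟨hmn, rfl, hq⟩ := hL <;> cases δ <;>
    simp [InBand, abs_lt, -abs_mul] at hz ⊢ <;> omega

lemma add_shift_mem_frameSection_iff (hL : L.Carries m n p q) (hu : u ∈ frameSection m n e)
    (hd : d ≠ 0) : u + shift p q d ∈ frameSection p q d ↔ d ∈ L.dirs e := by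
  rw [dirs, Finset.mem_filter_univ, and_iff_right hd, shift, dirVector]
  split_ifs
  · exact and_congr (hL.inBand_add_side_iff hu.1) (hL.inBand_add_side_iff hu.2)
  · exact and_congr (hL.inBand_add_corner_iff hu.1) (hL.inBand_add_corner_iff hu.2)

lemma mem_board_of_liesOver (hL : L.Carries m n p q) (h : LiesOver p q s u) :
    u ∈ board (m + n) := by
  obtain ⟨d, -, hs, rfl⟩ := h
  rw [shift, dirVector] at hs
  simp only [board, Set.mem_ofPred_eq, Nat.cast_add]
  split_ifs at hs
  · exact ⟨hL.abs_lt_of_inBand_add_side hs.1, hL.abs_lt_of_inBand_add_side hs.2⟩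
  · exact ⟨hL.abs_lt_of_inBand_add_corner hs.1, hL.abs_lt_of_inBand_add_corner hs.2⟩

lemma liesOver_iff (hL : L.Carries m n p q) (hu : u ∈ frameSection m n e) :
    LiesOver p q s u ↔ ∃ d ∈ L.dirs e, s = u + shift p q d := by
  constructor
  · rintro ⟨d, hd, hs, rfl⟩
    exact ⟨d, (hL.add_shift_mem_frameSection_iff hu hd).1 hs, rfl⟩
  · rintro ⟨d, hde, rfl⟩
    have hd : d ≠ 0 := (Finset.mem_filter.1 hde).2.1
    exact ⟨d, hd, (hL.add_shift_mem_frameSection_iff hu hd).2 hde, rfl⟩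

end Lifting.Carries

namespace Lifting

lemma dirs_nonempty (L : Lifting) (e : SignType × SignType) (h : e ≠ 0 ∨ L ≠ .f) :
    (L.dirs e).Nonempty := by
  revert e
  cases L <;> decide

lemma dirs_eq_arc (L : Lifting) (e : SignType × SignType) :
    ∃ d₀ k, L.dirs e = (Finset.range k).image (next^[·] d₀) := by
  have exists_le : ∀ e, ∃ d₀, ∃ k ≤ 8, L.dirs e = (Finset.range k).image (next^[·] d₀) := by
    cases L <;> decide
  obtain ⟨d₀, k, -, h⟩ := exists_le e
  exact ⟨d₀, k, h⟩

end Lifting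

section Neighbors

variable {p q : ℕ} {u : ℤ × ℤ} {d c d' : SignType × SignType} {x : ℤ} {δ ε γ η : SignType}

lemma InBand.eq_or_eq_neg_of_corner (hpq : p < q) (hδ : δ ≠ 0) (hγ : γ = 0 ∨ γ = -δ)
    (h : InBand p q δ (x + p * δ)) (h' : InBand p q η (x + ((q : ℤ) - p) * γ)) :
    η = γ ∨ η = -δ := by
  rcases hγ with rfl | rfl <;> cases δ <;> cases η <;>
    simp [InBand, abs_lt, -abs_mul] at hδ h h' ⊢ <;> omega

lemma InBand.eq_or_eq_neg_of_side (hpq : p < q) (hγ : γ ≠ 0) (hδ : δ = 0 ∨ δ = -γ)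
    (h : InBand p q δ (x + ((q : ℤ) - p) * δ)) (h' : InBand p q η (x + p * γ)) :
    η = γ ∨ η = -δ := by
  rcases hδ with rfl | rfl <;> cases γ <;> cases η <;>
    simp [InBand, abs_lt, -abs_mul] at hγ h h' ⊢ <;> omega

lemma Consecutive.symm : Consecutive d c → Consecutive c d := by
  revert d c
  decide

lemma Consecutive.neg : Consecutive d c → Consecutive (-d) (-c) := by
  revert d c
  decide

lemma Consecutive.right_ne_zero (hdc : Consecutive d c) (hd : d ≠ 0) : c ≠ 0 := by
  revert d c
  decide

lemma consecutive_corner_iff (hδ : δ ≠ 0) (hε : ε ≠ 0) :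
    Consecutive (δ, ε) c ↔ c = (-δ, 0) ∨ c = (0, -ε) := by
  revert δ ε c
  decide

lemma Consecutive.exists_corner_side (hdc : Consecutive d c) (hd : d ≠ 0) :
    ∃ δ ε : SignType, δ ≠ 0 ∧ ε ≠ 0 ∧
      (d = (δ, ε) ∧ (c = (-δ, 0) ∨ c = (0, -ε)) ∨ c = (δ, ε) ∧ (d = (-δ, 0) ∨ d = (0, -ε))) := by
  revert c d
  decide

lemma Consecutive.eq_or_eq_neg (hdc : Consecutive d c) (hpq : p < q) (hd : d ≠ 0)
    (hs : u + shift p q d ∈ frameSection p q d) (ht : u + shift p q c ∈ frameSection p q d') :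
    d' = c ∨ d' = -d := by
  obtain ⟨δ', ε'⟩ := d'
  obtain ⟨⟨h1, h2⟩, h3, h4⟩ := And.intro hs ht
  obtain ⟨δ, ε, hδ, hε, ⟨rfl, hc⟩ | ⟨rfl, hd⟩⟩ := hdc.exists_corner_side hd
  · have hside : c.1 = 0 ∨ c.2 = 0 := by aesop
    rw [shift_of_corner hδ hε] at h1 h2
    rw [shift_of_side hside] at h3 h4
    have := h1.eq_or_eq_neg_of_corner hpq hδ (by aesop) h3
    have := h2.eq_or_eq_neg_of_corner hpq hε (by aesop) h4
    aesop
  · have hside : d.1 = 0 ∨ d.2 = 0 := by aesop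
    rw [shift_of_corner hδ hε] at h3 h4
    rw [shift_of_side hside] at h1 h2
    have := h1.eq_or_eq_neg_of_side hpq hδ (by aesop) h3
    have := h2.eq_or_eq_neg_of_side hpq hε (by aesop) h4
    aesop

lemma shift_neg (p q : ℕ) (d : SignType × SignType) : shift p q (-d) = -shift p q d := by
  fin_cases d <;> simp [shift, dirVector]

end Neighbors

namespace Lifting.Carries

variable {L : Lifting} {m n p q : ℕ} {s t u v : ℤ × ℤ} {d c : SignType × SignType} {x : ℤ}
  {δ γ : SignType}

lemma moveGraph_adj_iff_exists_consecutive (hL : L.Carries m n p q) : (moveGraph m n).Adj u v ↔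
    ∃ d c, d.1 ≠ 0 ∧ d.2 ≠ 0 ∧ Consecutive d c ∧ v = u + shift p q d + shift p q c := by
  have exists_sign {a b r : ℤ} :
      (∃ δ : SignType, δ ≠ 0 ∧ b = a + r * δ) ↔ b = a + r ∨ b = a - r := by
    constructor
    · rintro ⟨δ, hδ, rfl⟩
      cases δ <;> simp [sub_eq_add_neg] at hδ ⊢
    · rintro (rfl | rfl)
      · exact ⟨1, by decide, by simp⟩
      · exact ⟨-1, by decide, by simp [sub_eq_add_neg]⟩
  obtain ⟨x, y⟩ := u
  obtain ⟨z, w⟩ := v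
  have shift_add (δ ε : SignType) (hδ : δ ≠ 0) (hε : ε ≠ 0) :
      (x, y) + shift p q (δ, ε) + shift p q (-δ, 0) = (x + (2 * p - q) * δ, y + p * ε) ∧
        (x, y) + shift p q (δ, ε) + shift p q (0, -ε) = (x + p * δ, y + (2 * p - q) * ε) := by
    rw [shift_of_corner (d := (δ, ε)) hδ hε, shift_of_side (.inr rfl), shift_of_side (.inl rfl)]
    constructor <;> ext <;> simp <;> ring
  calc (moveGraph m n).Adj (x, y) (z, w)
    _ ↔ ((z = x + (2 * p - q) ∨ z = x - (2 * p - q)) ∧ (w = y + p ∨ w = y - p)) ∨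
        ((z = x + p ∨ z = x - p) ∧ (w = y + (2 * p - q) ∨ w = y - (2 * p - q))) := by
      rw [moveGraph_adj_iff hL.lt_base.pos]
      cases L <;> obtain ⟨-, rfl, hq⟩ := hL <;> omega
    _ ↔ _ := by
      simp only [← exists_sign]
      constructor
      · rintro (⟨⟨δ, hδ, rfl⟩, ε, hε, rfl⟩ | ⟨⟨δ, hδ, rfl⟩, ε, hε, rfl⟩)
        · exact ⟨(δ, ε), (-δ, 0), hδ, hε, (consecutive_corner_iff hδ hε).2 (.inl rfl),
            (shift_add δ ε hδ hε).1.symm⟩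
        · exact ⟨(δ, ε), (0, -ε), hδ, hε, (consecutive_corner_iff hδ hε).2 (.inr rfl),
            (shift_add δ ε hδ hε).2.symm⟩
      · rintro ⟨⟨δ, ε⟩, c, hδ, hε, hc, h⟩
        obtain rfl | rfl := (consecutive_corner_iff hδ hε).1 hc
        · rw [(shift_add δ ε hδ hε).1, Prod.mk.injEq] at h
          exact .inl ⟨⟨δ, hδ, h.1⟩, ε, hε, h.2⟩
        · rw [(shift_add δ ε hδ hε).2, Prod.mk.injEq] at h
          exact .inr ⟨⟨δ, hδ, h.1⟩, ε, hε, h.2⟩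

lemma moveGraph_adj_of_consecutive (hL : L.Carries m n p q) (hd : d ≠ 0) (hdc : Consecutive d c) :
    (moveGraph m n).Adj u (u + shift p q d + shift p q c) := by
  rw [hL.moveGraph_adj_iff_exists_consecutive]
  obtain ⟨δ, ε, hδ, hε, ⟨rfl, -⟩ | ⟨rfl, -⟩⟩ := hdc.exists_corner_side hd
  · exact ⟨(δ, ε), c, hδ, hε, hdc, rfl⟩
  · exact ⟨(δ, ε), d, hδ, hε, hdc.symm, add_right_comm _ _ _⟩

lemma inBand_add_corner_of_abs_lt (hL : Carries .g m n p q) (hδ : δ ≠ 0) (hγ : γ = 0 ∨ γ = -δ)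
    (hx : |2 * x| < (m : ℤ) + n) (hx' : |2 * (x + p * δ + ((q : ℤ) - p) * γ)| < (m : ℤ) + n) :
    InBand p q δ (x + p * δ) := by
  obtain ⟨hmn, rfl, hq⟩ := hL
  rw [abs_lt] at hx hx'
  rcases hγ with rfl | rfl <;> cases δ <;> simp [InBand] at hδ hx' ⊢ <;> omega

lemma inBand_add_side_of_abs_lt (hL : L.Carries m n p q) (hg : L ≠ .g) (hγ : γ ≠ 0)
    (hδ : δ = 0 ∨ δ = -γ) (hx : |2 * x| < (m : ℤ) + n)
    (hx' : |2 * (x + ((q : ℤ) - p) * δ + p * γ)| < (m : ℤ) + n) :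
    InBand p q δ (x + ((q : ℤ) - p) * δ) := by
  rw [abs_lt] at hx hx'
  cases L <;> obtain ⟨hmn, rfl, hq⟩ := hL <;> first | exact absurd rfl hg | skip
  all_goals
    rcases hδ with rfl | rfl <;> cases γ <;>
      simp [InBand, abs_lt, -abs_mul] at hγ hx' ⊢ <;> omega

lemma add_shift_mem_frameSection_of_consecutive (hL : L.Carries m n p q) (hd : d ≠ 0)
    (hdc : Consecutive d c) (hg : L = .g ↔ d.1 ≠ 0 ∧ d.2 ≠ 0) (hu : u ∈ board (m + n))
    (hv : u + shift p q d + shift p q c ∈ board (m + n)) :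
    u + shift p q d ∈ frameSection p q d := by
  simp only [board, Set.mem_ofPred_eq, Nat.cast_add] at hu hv
  obtain ⟨δ, ε, hδ, hε, ⟨rfl, hc⟩ | ⟨rfl, hd⟩⟩ := hdc.exists_corner_side hd
  · obtain rfl := hg.2 ⟨hδ, hε⟩
    have hside : c.1 = 0 ∨ c.2 = 0 := by aesop
    rw [shift_of_corner (d := (δ, ε)) hδ hε, shift_of_side hside] at hv
    rw [shift_of_corner (d := (δ, ε)) hδ hε]
    exact ⟨hL.inBand_add_corner_of_abs_lt hδ (by aesop) hu.1 hv.1,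
      hL.inBand_add_corner_of_abs_lt hε (by aesop) hu.2 hv.2⟩
  · have hside : d.1 = 0 ∨ d.2 = 0 := by aesop
    have hg : L ≠ .g := by tauto
    rw [shift_of_corner (d := (δ, ε)) hδ hε, shift_of_side hside] at hv
    rw [shift_of_side hside]
    exact ⟨hL.inBand_add_side_of_abs_lt hg hδ (by aesop) hu.1 hv.1,
      hL.inBand_add_side_of_abs_lt hg hε (by aesop) hu.2 hv.2⟩

lemma exists_liesOver_adj_liesOver (hL : L.Carries m n p q) (h : (boardGraph m n).Adj u v) :
    ∃ s t, LiesOver p q s u ∧ LiesOver p q t v ∧ (boardGraph p q).Adj s t := by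
  obtain ⟨hu, hv, h⟩ := boardGraph_adj.1 h
  obtain ⟨d, c, hd, hdc, hg, rfl⟩ : ∃ d c, d ≠ 0 ∧ Consecutive d c ∧
      (L = .g ↔ d.1 ≠ 0 ∧ d.2 ≠ 0) ∧ v = u + shift p q d + shift p q c := by
    obtain ⟨d, c, hd₁, hd₂, hdc, rfl⟩ := hL.moveGraph_adj_iff_exists_consecutive.1 h
    have hd : d ≠ 0 := fun hd => hd₁ (congrArg Prod.fst hd)
    by_cases hg : L = .g
    · exact ⟨d, c, hd, hdc, iff_of_true hg ⟨hd₁, hd₂⟩, rfl⟩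
    · have hc : ¬(c.1 ≠ 0 ∧ c.2 ≠ 0) := by
        obtain rfl | rfl := (consecutive_corner_iff hd₁ hd₂).1 hdc <;> simp
      exact ⟨c, d, hdc.right_ne_zero hd, hdc.symm, iff_of_false hg hc, add_right_comm _ _ _⟩
  have neg_ne : ∀ d : SignType × SignType, d ≠ 0 → -d ≠ 0 := by decide
  have neg_corner : ∀ d : SignType × SignType,
      (d.1 ≠ 0 ∧ d.2 ≠ 0 ↔ (-d).1 ≠ 0 ∧ (-d).2 ≠ 0) := by decide
  have hd' := neg_ne d hd
  have hg' := hg.trans (neg_corner d)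
  have hu' : u + shift p q d + shift p q c + shift p q (-d) + shift p q (-c) = u := by
    simp only [shift_neg]
    abel
  have hs := hL.add_shift_mem_frameSection_of_consecutive hd hdc hg hu hv
  have ht := hL.add_shift_mem_frameSection_of_consecutive hd' hdc.neg hg' hv (hu'.symm ▸ hu)
  refine ⟨_, _, ⟨d, hd, hs, rfl⟩, ⟨-d, hd', ht, rfl⟩, ?_⟩
  rw [boardGraph_adj_iff_consecutive hL.lt hd hs]
  refine ⟨c, hdc, ?_⟩
  rw [shift_neg]
  abel

lemma eq_or_adj_of_liesOver (hL : L.Carries m n p q) (hs : LiesOver p q s u)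
    (ht : LiesOver p q t v) (hst : (boardGraph p q).Adj s t) :
    v = u ∨ (boardGraph m n).Adj u v := by
  have hu := hL.mem_board_of_liesOver hs
  have hv := hL.mem_board_of_liesOver ht
  obtain ⟨d, hd, hs, rfl⟩ := hs
  obtain ⟨d', -, ht, rfl⟩ := ht
  obtain ⟨c, hdc, h⟩ := (boardGraph_adj_iff_consecutive hL.lt hd hs).1 hst
  rw [add_sub_cancel_right] at h
  obtain rfl | rfl := hdc.eq_or_eq_neg hL.lt hd hs (h ▸ ht)
  · exact .inl (add_right_cancel h)
  · have hv' : v = u + shift p q d + shift p q c := by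
      rw [shift_neg] at h
      rw [add_right_comm, ← h, neg_add_cancel_right]
    exact .inr (boardGraph_adj.2 ⟨hu, hv, hv' ▸ hL.moveGraph_adj_of_consecutive hd hdc⟩)

lemma component_eq_of_liesOver (hL : L.Carries m n p q) (hu : u ∈ board (m + n))
    (hodd : Odd (p + q)) (hs : LiesOver p q s u) (ht : LiesOver p q t u) :
    component p q s = component p q t := by
  obtain ⟨e, he⟩ := (mem_board_iff_exists_frameSection (hL.odd_iff.1 hodd)).1 hu
  obtain ⟨d₀, k, hdirs⟩ := L.dirs_eq_arc e
  have hsucc (j : ℕ) (hj : j + 1 < k) :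
      (boardGraph p q).Adj (u + shift p q (next^[j] d₀)) (u + shift p q (next^[j + 1] d₀)) := by
    have hmem : next^[j] d₀ ∈ L.dirs e := by
      rw [hdirs]
      exact Finset.mem_image_of_mem _ (Finset.mem_range.2 (by omega))
    have hne : next^[j] d₀ ≠ 0 := (Finset.mem_filter.1 hmem).2.1
    rw [boardGraph_adj_iff_consecutive hL.lt hne
      ((hL.add_shift_mem_frameSection_iff he hne).2 hmem)]
    exact ⟨_, .inl (Function.iterate_succ_apply' _ _ _), by rw [add_sub_cancel_right]⟩
  have hreach (j : ℕ) (hj : j < k) : component p q (u + shift p q (next^[j] d₀)) =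
      component p q (u + shift p q d₀) := by
    induction j with
    | zero => rfl
    | succ j ih =>
      rw [← ih (by omega)]
      exact component_eq_of_mem (hsucc j hj).reachable
  have hcomp {r} (hr : LiesOver p q r u) : component p q r = component p q (u + shift p q d₀) := by
    obtain ⟨d, hd, rfl⟩ := (hL.liesOver_iff he).1 hr
    obtain ⟨j, hj, rfl⟩ := Finset.mem_image.1 (hdirs ▸ hd)
    exact hreach j (Finset.mem_range.1 hj)
  rw [hcomp hs, hcomp ht]

theorem component_eq_liftTo (hL : L.Carries m n p q) (hodd : Odd (p + q))
    (hs : LiesOver p q s u) : component p q s = liftTo p q (component m n u) := by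
  apply subset_antisymm
  · refine component_subset (mem_liftTo.2 ⟨u, self_mem_component m n u, hs⟩) fun s t hst hs => ?_
    obtain ⟨v, hv, hsv⟩ := mem_liftTo.1 hs
    obtain ⟨w, hw⟩ := exists_liesOver (mem_frame_of_adj hL.lt hodd hst.symm)
    obtain rfl | hvw := hL.eq_or_adj_of_liesOver hsv hw hst
    · exact mem_liftTo.2 ⟨w, hv, hw⟩
    · exact mem_liftTo.2 ⟨w, hv.trans hvw.reachable, hw⟩
  · have hsub : component m n u ⊆
        {v | ∀ t, LiesOver p q t v → component p q t = component p q s} := by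
      refine component_subset (fun t ht => ?_) fun v w hvw hv t ht => ?_
      · exact hL.component_eq_of_liesOver (hL.mem_board_of_liesOver hs) hodd ht hs
      · obtain ⟨s', t', hs', ht', hst'⟩ := hL.exists_liesOver_adj_liesOver hvw
        rw [hL.component_eq_of_liesOver (boardGraph_adj.1 hvw).2.1 hodd ht ht', ← hv s' hs']
        exact component_eq_of_mem hst'.reachable
    intro t ht
    obtain ⟨v, hv, htv⟩ := mem_liftTo.1 ht
    exact hsub hv t htv ▸ self_mem_component p q t

end Lifting.Carries

/-! ### Lifting of cycles -/

namespace Lifting.Carries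

variable {L L' : Lifting} {m n p q m' n' : ℕ} {s u : ℤ × ℤ} {S T U : Set (ℤ × ℤ)}

lemma exists_liesOver_of_mem_frameSection {e : SignType × SignType} (hL : L.Carries m n p q)
    (hu : u ∈ frameSection m n e) (he : e ≠ 0 ∨ L ≠ .f) : ∃ s, LiesOver p q s u := by
  obtain ⟨d, hd⟩ := L.dirs_nonempty e he
  exact ⟨_, (hL.liesOver_iff hu).2 ⟨d, hd, rfl⟩⟩

lemma subset_of_liftTo_subset (hL : L.Carries m n p q) (hT : T ⊆ frame m n)
    (h : liftTo p q T ⊆ liftTo p q U) : T ⊆ U := by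
  intro u hu
  obtain ⟨e, he, hue⟩ := hT hu
  obtain ⟨s, hs⟩ := hL.exists_liesOver_of_mem_frameSection hue (.inl he)
  obtain ⟨v, hv, hsv⟩ := mem_liftTo.1 (h (mem_liftTo.2 ⟨u, hu, hs⟩))
  exact hs.unique hL.lt hsv ▸ hv

lemma component_eq_singleton (hL : L.Carries m n p q) (hodd : Odd (p + q))
    (hu : u ∈ frameSection m n 0) : component m n u = {u} := by
  refine (component_subset (A := {u}) rfl fun v w hvw hv => ?_).antisymm
    (Set.singleton_subset_iff.2 (self_mem_component m n u))
  obtain ⟨e, he, hve⟩ := mem_frame_of_adj hL.lt_base (hL.odd_iff.1 hodd) hvw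
  obtain rfl : v = u := hv
  exact absurd (frameSection_unique hL.lt_base hve hu) he

theorem isCycleSet_iff (hL : L.Carries m n p q) (hodd : Odd (p + q)) : IsCycleSet p q S ↔
    (∃ T, IsCycleSet m n T ∧ S = liftTo p q T) ∨
      L ≠ .f ∧ ∃ u ∈ frameSection m n 0, S = liftTo p q {u} := by
  have hodd' := hL.odd_iff.1 hodd
  rw [Leaper.isCycleSet_iff hL.lt hodd]
  constructor
  · rintro ⟨s, hs, rfl⟩
    obtain ⟨u, hsu⟩ := exists_liesOver hs
    obtain ⟨e, hu⟩ := (mem_board_iff_exists_frameSection hodd').1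
      (hL.mem_board_of_liesOver hsu)
    rw [hL.component_eq_liftTo hodd hsu]
    by_cases he : e = 0
    · subst he
      refine .inr ⟨?_, u, hu, by rw [hL.component_eq_singleton hodd hu]⟩
      rintro rfl
      obtain ⟨d, hd, -⟩ := (hL.liesOver_iff hu).1 hsu
      revert d
      decide
    · exact .inl ⟨_, isCycleSet_component hL.lt_base hodd' ⟨e, he, hu⟩, rfl⟩
  · rintro (⟨T, hT, rfl⟩ | ⟨hf, u, hu, rfl⟩)
    · obtain ⟨u, ⟨e, he, hu⟩, rfl⟩ := (Leaper.isCycleSet_iff hL.lt_base hodd').1 hT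
      obtain ⟨s, hs⟩ := hL.exists_liesOver_of_mem_frameSection hu (.inl he)
      exact ⟨s, hs.mem_frame, (hL.component_eq_liftTo hodd hs).symm⟩
    · obtain ⟨s, hs⟩ := hL.exists_liesOver_of_mem_frameSection hu (.inr hf)
      rw [← hL.component_eq_singleton hodd hu]
      exact ⟨s, hs.mem_frame, (hL.component_eq_liftTo hodd hs).symm⟩

lemma le_three_mul (hL : L.Carries m n p q) (hf : L ≠ .f) : q ≤ 3 * p := by
  cases L <;> obtain ⟨hmn, rfl, hq⟩ := hL <;> first | exact absurd rfl hf | omega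

lemma unique (hL : L.Carries m n p q) (hL' : L'.Carries m' n' p q) (hm' : 0 < m') :
    L = L' ∧ m = m' ∧ n = n' := by
  cases L <;> cases L' <;> obtain ⟨hmn, rfl, hq⟩ := hL <;> obtain ⟨hmn', hp', hq'⟩ := hL' <;>
    simp only [reduceCtorEq, false_and, true_and] <;> omega

end Lifting.Carries

lemma exists_carries {p q : ℕ} (hp : 0 < p) (hpq : p < q) (hodd : Odd (p + q)) :
    ∃ L m n, Lifting.Carries L m n p q := by
  rw [Nat.odd_iff] at hodd
  obtain h | h | h : q < 2 * p ∨ (2 * p ≤ q ∧ q < 3 * p) ∨ 3 * p < q := by omega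
  · exact ⟨.g, 2 * p - q, p, by omega, rfl, by omega⟩
  · exact ⟨.h, q - 2 * p, p, by omega, rfl, by omega⟩
  · exact ⟨.f, p, q - 2 * p, by omega, rfl, by omega⟩

/-! ### Shells and types -/

lemma inSpan_iff {w a b c x : ℤ} {δ : SignType} (ha : a = 2 * c - w) (hb : b = 2 * c + w) :
    InSpan w a b δ x ↔ |2 * (x - c * δ)| < w := by
  subst ha hb
  cases δ <;> simp [InSpan, abs_lt, -abs_mul] <;> omega

lemma Lifting.Carries.shell_eq_liftTo {L : Lifting} {m n p q : ℕ} (hL : L.Carries m n p q)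
    (hf : L ≠ .f) : shell p q = liftTo p q (frameSection m n 0) := by
  have mem_dirs_zero : ∀ d ≠ 0, d ∈ L.dirs 0 := by
    cases L <;> first | exact absurd rfl hf | decide
  ext s
  refine exists_congr fun d => and_congr_right fun hd => ?_
  have mem_iff : s - shift p q d ∈ frameSection m n 0 ↔
      s ∈ frameSection p q d ∧ s - shift p q d ∈ frameSection m n 0 := by
    refine ⟨fun h => ⟨?_, h⟩, And.right⟩
    rw [← sub_add_cancel s (shift p q d)]
    exact (hL.add_shift_mem_frameSection_iff h hd).2 (mem_dirs_zero d hd)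
  change _ ↔ s ∈ frameSection p q d ∧ s - shift p q d ∈ frameSection m n 0
  rw [← mem_iff, shift, dirVector]
  change _ ↔ |2 * (s - _).1| < (n : ℤ) - m ∧ |2 * (s - _).2| < (n : ℤ) - m
  have side_eq : (if q ≤ 2 * p then (q : ℤ) - p else 3 * p - q) = n - m := by
    cases L <;> first | exact absurd rfl hf | skip
    all_goals
      obtain ⟨hmn, rfl, hq⟩ := hL
      split_ifs <;> omega
  rw [← side_eq]
  split_ifs <;> rw [inSpan_iff, inSpan_iff] <;> first | rfl | ring

/-- The amount by which a lifting increases the types of cycles. -/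
def Lifting.rise (L : Lifting) : ℕ := if L = .f then 0 else 1

section Types

variable {L : Lifting} {m n p q i j : ℕ} {S T : Set (ℤ × ℤ)}

lemma HasType.lift (hL : L.Carries m n p q) (hT : HasType m n j T) :
    HasType p q (j + L.rise) (liftTo p q T) := by
  cases L <;> obtain ⟨hmn, rfl, hq⟩ := hL
  · subst hq
    exact liftF_eq_liftTo ▸ hT.f p n j T hmn
  · obtain rfl : q = 2 * p - m := by omega
    exact liftG_eq_liftTo hmn ▸ hT.g m p j T hmn
  · subst hq
    exact liftH_eq_liftTo ▸ hT.h m p j T hmn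

@[elab_as_elim]
lemma HasType.rec_lifting {P : ∀ p q i S, HasType p q i S → Prop}
    (shell : ∀ p q S hp hpq hq hS hsub, P p q 1 S (.shell p q S hp hpq hq hS hsub))
    (lift : ∀ L m n p q j T (hL : Lifting.Carries L m n p q) (hT : HasType m n j T),
      P m n j T hT → P p q (j + L.rise) (liftTo p q T) (hT.lift hL))
    (hS : HasType p q i S) : P p q i S hS := by
  induction hS with
  | shell m n S hm hmn hn hS hsub => exact shell m n S hm hmn hn hS hsub
  | f m n i T hmn hT ih =>
    simp only [liftF_eq_liftTo]
    exact lift .f m n m (2 * m + n) i T ⟨hmn, rfl, rfl⟩ hT ih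
  | g m n i T hmn hT ih =>
    simp only [liftG_eq_liftTo hmn]
    exact lift .g m n n (2 * n - m) i T ⟨hmn, rfl, by omega⟩ hT ih
  | h m n i T hmn hT ih =>
    simp only [liftH_eq_liftTo]
    exact lift .h m n n (m + 2 * n) i T ⟨hmn, rfl, rfl⟩ hT ih

lemma HasType.pos_and_lt (hS : HasType p q i S) : 0 < p ∧ p < q := by
  induction hS <;> omega

lemma HasType.one_le (hS : HasType p q i S) : 1 ≤ i := by
  induction hS <;> omega

lemma HasType.isCycleSet (hS : HasType p q i S) (hodd : Odd (p + q)) : IsCycleSet p q S := by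
  induction hS using HasType.rec_lifting with
  | shell _ _ _ _ _ _ hS => exact hS
  | lift L m n p q _ T hL _ ih =>
    exact (hL.isCycleSet_iff hodd).2 (.inl ⟨T, ih (hL.odd_iff.1 hodd), rfl⟩)

lemma IsCycleSet.subset_frame (hpq : p < q) (hodd : Odd (p + q)) (hS : IsCycleSet p q S) :
    S ⊆ frame p q := by
  obtain ⟨s, hs, rfl⟩ := (isCycleSet_iff hpq hodd).1 hS
  exact component_subset_frame hpq hodd hs

lemma IsCycleSet.nonempty (hpq : p < q) (hodd : Odd (p + q)) (hS : IsCycleSet p q S) :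
    S.Nonempty := by
  obtain ⟨s, -, rfl⟩ := (isCycleSet_iff hpq hodd).1 hS
  exact ⟨s, self_mem_component p q s⟩

lemma disjoint_frame_hole (hpq : p < q) : Disjoint (frame p q) (frameSection p q 0) := by
  rw [Set.disjoint_left]
  rintro s ⟨d, hd, hs⟩ hs'
  exact hd (frameSection_unique hpq hs hs')

lemma IsCycleSet.not_subset_hole (hpq : p < q) (hodd : Odd (p + q)) (hS : IsCycleSet p q S) :
    ¬S ⊆ frameSection p q 0 := fun h =>
  (hS.nonempty hpq hodd).ne_empty
    (Set.subset_empty_iff.1 (disjoint_frame_hole hpq (hS.subset_frame hpq hodd) h))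

theorem hasType_iff (hL : L.Carries m n p q) (hodd : Odd (p + q)) : HasType p q i S ↔
    (∃ j T, i = j + L.rise ∧ HasType m n j T ∧ S = liftTo p q T) ∨
      L ≠ .f ∧ i = 1 ∧ ∃ u ∈ frameSection m n 0, S = liftTo p q {u} := by
  constructor
  · intro hS
    induction hS using HasType.rec_lifting with
    | shell p q S _ _ hq hS hsub =>
      have hf : L ≠ .f := by
        rintro rfl
        obtain ⟨hmn, rfl, rfl⟩ := hL
        omega
      refine .inr ⟨hf, rfl, ?_⟩
      obtain ⟨T, hT, rfl⟩ | ⟨-, h⟩ := (hL.isCycleSet_iff hodd).1 hS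
      · rw [hL.shell_eq_liftTo hf] at hsub
        have hodd' := hL.odd_iff.1 hodd
        exact absurd (hL.subset_of_liftTo_subset (hT.subset_frame hL.lt_base hodd') hsub)
          (hT.not_subset_hole hL.lt_base hodd')
      · exact h
    | lift L' m' n' p q j T hL' hT =>
      obtain ⟨rfl, rfl, rfl⟩ := hL.unique hL' hT.pos_and_lt.1
      exact .inl ⟨j, T, rfl, hT, rfl⟩
  · rintro (⟨j, T, rfl, hT, rfl⟩ | ⟨hf, rfl, u, hu, rfl⟩)
    · exact hT.lift hL
    · have hp : 0 < p := by
        have := hL.lt_base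
        cases L <;> obtain ⟨-, rfl, -⟩ := hL <;> first | exact absurd rfl hf | omega
      refine .shell p q _ hp hL.lt (hL.le_three_mul hf)
        ((hL.isCycleSet_iff hodd).2 (.inr ⟨hf, u, hu, rfl⟩)) ?_
      rw [hL.shell_eq_liftTo hf]
      rintro s hs
      obtain ⟨v, rfl, hv⟩ := mem_liftTo.1 hs
      exact mem_liftTo.2 ⟨v, hu, hv⟩

end Types

/-! ### Counting squares by section -/

/-- The directions NE, NW, SW and SE. -/
def cornerDirs : Finset (SignType × SignType) := {d | d.1 ≠ 0 ∧ d.2 ≠ 0}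

/-- The directions E, N, W and S. -/
def sideDirs : Finset (SignType × SignType) := {d | d ≠ 0 ∧ (d.1 = 0 ∨ d.2 = 0)}

/-- The number of squares of `S` in the sections of the `(p, q)`-frame with directions in `D`. -/
noncomputable def sectionCount (p q : ℕ) (D : Finset (SignType × SignType)) (S : Set (ℤ × ℤ)) : ℕ :=
  ∑ d ∈ D, (S ∩ frameSection p q d).ncard

/-- The four corner sections of the `(p, q)`-frame together contain `4 * x` squares of `S`, and the
four side sections `4 * y` squares. -/
def HasCounts (p q : ℕ) (S : Set (ℤ × ℤ)) (x y : ℕ) : Prop :=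
  sectionCount p q cornerDirs S = 4 * x ∧ sectionCount p q sideDirs S = 4 * y

/-- The counts `x` and `y` of `HasCounts` after a lifting. -/
def Lifting.counts : Lifting → ℕ × ℕ → ℕ × ℕ
  | f, (x, y) => (x, 2 * x + y)
  | g, (x, y) => (x + 2 * y, y)
  | h, (x, y) => (x + 2 * y, 2 * x + 3 * y)

section Counts

variable {L : Lifting} {m n p q x y : ℕ} {u : ℤ × ℤ} {S T : Set (ℤ × ℤ)}
  {d e : SignType × SignType} {D : Finset (SignType × SignType)}

lemma ncard_inter_iUnion_frameSection (hpq : p < q) (hS : S ⊆ board (p + q))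
    (D : Finset (SignType × SignType)) :
    (S ∩ ⋃ d ∈ D, frameSection p q d).ncard = sectionCount p q D S := by
  rw [Set.inter_iUnion₂, sectionCount, ← finsum_mem_coe_finset]
  refine D.finite_toSet.ncard_biUnion
    (fun d _ => (finite_board (p + q)).subset (Set.inter_subset_left.trans hS)) ?_
  intro d _ e _ hde
  rw [Function.onFun, Set.disjoint_left]
  exact fun s hd he => hde (frameSection_unique hpq hd.2 he.2)

lemma sum_directions (N : SignType × SignType → ℕ) :
    ∑ e, N e = N 0 + (∑ e ∈ cornerDirs, N e + ∑ e ∈ sideDirs, N e) := by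
  have univ_eq : Finset.univ = {0} ∪ (cornerDirs ∪ sideDirs) := by decide
  rw [univ_eq, Finset.sum_union (by decide), Finset.sum_union (by decide), Finset.sum_singleton]

lemma ncard_hole_inter_eq_zero (hpq : p < q) (hS : S ⊆ frame p q) :
    (S ∩ frameSection p q 0).ncard = 0 := by
  rw [((disjoint_frame_hole hpq).mono_left hS).inter_eq, Set.ncard_empty]

lemma HasCounts.ncard_eq (hpq : p < q) (hodd : Odd (p + q)) (hS : S ⊆ frame p q)
    (h : HasCounts p q S x y) : S.ncard = 4 * (x + y) := by
  have hS' := hS.trans frame_subset_board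
  have inter_eq : S ∩ ⋃ d ∈ Finset.univ, frameSection p q d = S := by
    refine Set.inter_eq_left.2 (hS'.trans fun s hs => ?_)
    simpa using (mem_board_iff_exists_frameSection hodd).1 hs
  rw [← inter_eq, ncard_inter_iUnion_frameSection hpq hS', sectionCount, sum_directions,
    ncard_hole_inter_eq_zero hpq hS, zero_add, ← sectionCount, ← sectionCount, h.1, h.2, mul_add]

namespace Lifting.Carries

lemma ncard_liftTo_inter (hL : L.Carries m n p q) (hodd : Odd (p + q)) (hT : T ⊆ board (m + n))
    (hd : d ≠ 0) : (liftTo p q T ∩ frameSection p q d).ncard =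
      sectionCount m n {e | d ∈ L.dirs e} T := by
  rw [← ncard_inter_iUnion_frameSection hL.lt_base hT,
    ← Set.ncard_image_of_injective (T ∩ _) (add_left_injective (shift p q d))]
  congr 1
  ext s
  constructor
  · rintro ⟨hs, hsd⟩
    obtain ⟨u, hu, d', -, hd', rfl⟩ := mem_liftTo.1 hs
    obtain rfl := frameSection_unique hL.lt hd' hsd
    obtain ⟨e, he⟩ := (mem_board_iff_exists_frameSection (hL.odd_iff.1 hodd)).1 (hT hu)
    refine ⟨u, ⟨hu, Set.mem_iUnion₂.2 ⟨e, ?_, he⟩⟩, rfl⟩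
    exact (Finset.mem_filter_univ e).2 ((hL.add_shift_mem_frameSection_iff he hd).1 hd')
  · rintro ⟨u, ⟨hu, he⟩, rfl⟩
    obtain ⟨e, hde, he⟩ := Set.mem_iUnion₂.1 he
    have hs := (hL.add_shift_mem_frameSection_iff he hd).2 ((Finset.mem_filter_univ e).1 hde)
    exact ⟨mem_liftTo.2 ⟨u, hu, d, hd, hs, rfl⟩, hs⟩

lemma sectionCount_liftTo (hL : L.Carries m n p q) (hodd : Odd (p + q)) (hT : T ⊆ board (m + n))
    (hD : 0 ∉ D) : sectionCount p q D (liftTo p q T) =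
      ∑ e, (D ∩ L.dirs e).card * (T ∩ frameSection m n e).ncard := by
  calc sectionCount p q D (liftTo p q T)
    _ = ∑ d ∈ D, ∑ e with d ∈ L.dirs e, (T ∩ frameSection m n e).ncard :=
      Finset.sum_congr rfl fun d hd =>
        hL.ncard_liftTo_inter hodd hT (ne_of_mem_of_not_mem hd hD)
    _ = ∑ e, ∑ _ ∈ D ∩ L.dirs e, (T ∩ frameSection m n e).ncard :=
      Finset.sum_comm' fun _ _ => by simp [and_comm]
    _ = _ := by simp only [Finset.sum_const, smul_eq_mul]

lemma hasCounts_liftTo (hL : L.Carries m n p q) (hodd : Odd (p + q)) (hT : T ⊆ frame m n)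
    (h : HasCounts m n T x y) :
    HasCounts p q (liftTo p q T) (L.counts (x, y)).1 (L.counts (x, y)).2 := by
  have hT' := hT.trans frame_subset_board
  have card_corner : ∀ e ∈ cornerDirs, (cornerDirs ∩ L.dirs e).card = (L.counts (1, 0)).1 ∧
      (sideDirs ∩ L.dirs e).card = (L.counts (1, 0)).2 := by
    cases L <;> decide
  have card_side : ∀ e ∈ sideDirs, (cornerDirs ∩ L.dirs e).card = (L.counts (0, 1)).1 ∧
      (sideDirs ∩ L.dirs e).card = (L.counts (0, 1)).2 := by
    cases L <;> decide
  have sectionCount_eq {D a b} (hD : 0 ∉ D) (ha : ∀ e ∈ cornerDirs, (D ∩ L.dirs e).card = a)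
      (hb : ∀ e ∈ sideDirs, (D ∩ L.dirs e).card = b) :
      sectionCount p q D (liftTo p q T) = a * (4 * x) + b * (4 * y) := by
    rw [hL.sectionCount_liftTo hodd hT' hD, sum_directions,
      ncard_hole_inter_eq_zero hL.lt_base hT, mul_zero, zero_add, ← h.1, ← h.2, sectionCount,
      sectionCount, Finset.mul_sum, Finset.mul_sum]
    exact congrArg₂ _ (Finset.sum_congr rfl fun e he => by rw [ha e he])
      (Finset.sum_congr rfl fun e he => by rw [hb e he])
  constructor
  · rw [sectionCount_eq (by decide) (fun e he => (card_corner e he).1)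
      fun e he => (card_side e he).1]
    cases L <;> simp only [counts] <;> ring
  · rw [sectionCount_eq (by decide) (fun e he => (card_corner e he).2)
      fun e he => (card_side e he).2]
    cases L <;> simp only [counts] <;> ring

lemma hasCounts_liftTo_singleton (hL : L.Carries m n p q) (hodd : Odd (p + q)) (hf : L ≠ .f)
    (hu : u ∈ frameSection m n 0) : HasCounts p q (liftTo p q {u}) 1 1 := by
  have sectionCount_eq {D} (hD : 0 ∉ D) :
      sectionCount p q D (liftTo p q {u}) = (D ∩ L.dirs 0).card := by
    have hub : {u} ⊆ board (m + n) := Set.singleton_subset_iff.2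
      ((mem_board_iff_exists_frameSection (hL.odd_iff.1 hodd)).2 ⟨0, hu⟩)
    rw [hL.sectionCount_liftTo hodd hub hD, Finset.sum_eq_single 0]
    · rw [Set.inter_eq_left.2 (Set.singleton_subset_iff.2 hu), Set.ncard_singleton, mul_one]
    · intro e _ he
      have : {u} ∩ frameSection m n e = ∅ := by
        rw [Set.singleton_inter_eq_empty]
        exact fun hue => he (frameSection_unique hL.lt_base hue hu)
      rw [this, Set.ncard_empty, mul_zero]
    · simp
  rw [HasCounts, sectionCount_eq (by decide), sectionCount_eq (by decide)]
  cases L <;> first | exact absurd rfl hf | decide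

end Lifting.Carries

end Counts

/-! ### Even continued fractions -/

section ContinuedFractions

variable {c : ℕ → ℤ} {s : ℕ → ℤˣ} {k : ℕ}

lemma cfValue_one (c : ℕ → ℤ) (s : ℕ → ℤˣ) : cfValue c s 1 = c 1 := by
  simp [cfValue, signedCF]

lemma lengthRatio_one (c : ℕ → ℤ) (s : ℕ → ℤˣ) : lengthRatio c s 1 = c 1 := by
  simp [lengthRatio, signedCF]

lemma list_Ico_one_succ (hk : 1 ≤ k) :
    List.Ico 1 (k + 1) = 1 :: (List.Ico 1 k).map (· + 1) := by
  rw [List.Ico.eq_cons (by omega), List.cons_inj_right]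
  simpa only [add_comm] using (List.Ico.map_add 1 k 1).symm

lemma cfValue_succ (c : ℕ → ℤ) (s : ℕ → ℤˣ) (hk : 1 ≤ k) :
    cfValue c s (k + 1) =
      c 1 + ((s 1 : ℤ) : ℚ) / cfValue (fun j => c (j + 1)) (fun j => s (j + 1)) k := by
  rw [cfValue, list_Ico_one_succ hk, List.map_cons, List.map_map, signedCF, cfValue]
  rfl

lemma lengthRatio_succ (c : ℕ → ℤ) (s : ℕ → ℤˣ) (hk : 1 ≤ k) :
    lengthRatio c s (k + 1) = c 1 + ((s 1 : ℤ) : ℚ) /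
      (2 - 1 / lengthRatio (fun j => c (j + 1)) (fun j => s (j + 1)) k) := by
  simp [lengthRatio, list_Ico_one_succ hk, List.flatMap_map, signedCF, neg_div, sub_eq_add_neg]

lemma cfValue_update_one (c : ℕ → ℤ) (s : ℕ → ℤˣ) (a : ℤ) (hk : 1 ≤ k) :
    cfValue (Function.update c 1 (c 1 + a)) s k = cfValue c s k + a := by
  obtain rfl | hk := hk.eq_or_lt
  · simp [cfValue_one]
  · have map_eq : (List.Ico 2 k).map (fun j => (Function.update c 1 (c 1 + a) j, s j)) =
        (List.Ico 2 k).map fun j => (c j, s j) := by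
      refine List.map_congr_left fun j hj => ?_
      rw [Function.update_of_ne (by have := List.Ico.mem.1 hj; omega)]
    simp only [cfValue, List.Ico.eq_cons hk, List.map_cons, map_eq, signedCF,
      Function.update_self, Function.update_of_ne hk.ne']
    push_cast
    ring

lemma lengthRatio_update_one (c : ℕ → ℤ) (s : ℕ → ℤˣ) (a : ℤ) (hk : 1 ≤ k) :
    lengthRatio (Function.update c 1 (c 1 + a)) s k = lengthRatio c s k + a := by
  obtain rfl | hk := hk.eq_or_lt
  · simp [lengthRatio_one]
  · have flatMap_eq :
        (List.Ico 2 k).flatMap (fun j => [(Function.update c 1 (c 1 + a) j, s j), (2, -1)]) =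
          (List.Ico 2 k).flatMap fun j => [(c j, s j), (2, -1)] := by
      refine List.flatMap_congr fun j hj => ?_
      rw [Function.update_of_ne (by have := List.Ico.mem.1 hj; omega)]
    simp only [lengthRatio, List.Ico.eq_cons hk, List.flatMap_cons, List.cons_append,
      List.nil_append, flatMap_eq, signedCF, Function.update_self, Function.update_of_ne hk.ne']
    push_cast
    ring

lemma one_lt_cfValue (hk : 1 ≤ k) : ∀ (c : ℕ → ℤ) (s : ℕ → ℤˣ),
    (∀ i ∈ Finset.Icc 1 k, 2 ≤ c i) → 1 < cfValue c s k := by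
  induction k, hk using Nat.le_induction with
  | base =>
    intro c s hc
    rw [cfValue_one]
    exact_mod_cast hc 1 (by simp)
  | succ k hk ih =>
    intro c s hc
    rw [cfValue_succ c s hk]
    have one_lt := ih (fun j => c (j + 1)) (fun j => s (j + 1)) fun i hi =>
      hc _ (by rw [Finset.mem_Icc] at hi ⊢; omega)
    set v := cfValue (fun j => c (j + 1)) (fun j => s (j + 1)) k
    have two_le : (2 : ℚ) ≤ c 1 := mod_cast hc 1 (by simp)
    have inv_lt : 1 / v < 1 := (div_lt_one (by linarith)).2 one_lt
    have inv_pos : 0 < 1 / v := by positivity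
    rcases Int.units_eq_one_or (s 1) with hs | hs <;> rw [hs] <;> push_cast
    · linarith
    · rw [neg_div]
      linarith

namespace IsEvenCF

lemma two_le (hc : IsEvenCF c k) {i : ℕ} (hi : i ∈ Finset.Icc 2 k) : 2 ≤ c i := by
  obtain ⟨r, hr⟩ := hc.2.1 i (by rw [Finset.mem_Icc] at hi ⊢; omega)
  have := hc.2.2.2 i hi
  omega

lemma even_one (hc : IsEvenCF c k) : Even (c 1) := hc.2.1 1 (Finset.mem_Icc.2 ⟨le_rfl, hc.1⟩)

lemma tail (hc : IsEvenCF c (k + 1)) (hk : 1 ≤ k) : IsEvenCF (fun j => c (j + 1)) k := by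
  refine ⟨hk, fun i hi => hc.2.1 _ ?_, (hc.2.2.2 _ ?_).le, fun i hi => hc.2.2.2 _ ?_⟩ <;>
    simp only [Finset.mem_Icc] at * <;> omega

lemma one_lt_cfValue_tail (hc : IsEvenCF c (k + 1)) (hk : 1 ≤ k) (s : ℕ → ℤˣ) :
    1 < cfValue (fun j => c (j + 1)) s k :=
  one_lt_cfValue hk _ s fun i hi => hc.two_le (by rw [Finset.mem_Icc] at hi ⊢; omega)

lemma abs_sub_lt_one (hc : IsEvenCF c k) (s : ℕ → ℤˣ) : |cfValue c s k - c 1| < 1 := by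
  obtain rfl | hk := hc.1.eq_or_lt
  · simp [cfValue_one]
  · obtain ⟨k, rfl⟩ : ∃ j, k = j + 1 := ⟨k - 1, by omega⟩
    have one_lt := hc.one_lt_cfValue_tail (by omega) fun j => s (j + 1)
    rw [cfValue_succ c s (by omega), add_sub_cancel_left, abs_div,
      abs_of_pos (zero_lt_one.trans one_lt), div_lt_one (zero_lt_one.trans one_lt),
      ← Int.cast_abs, Int.isUnit_iff_abs_eq.1 (s 1).isUnit, Int.cast_one]
    exact one_lt

lemma one_eq_two (hc : IsEvenCF c k) (h₁ : 1 < cfValue c s k) (h₃ : cfValue c s k < 3) :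
    c 1 = 2 := by
  have h := abs_lt.1 (hc.abs_sub_lt_one s)
  have pos : (0 : ℚ) < c 1 := by linarith
  have lt : (c 1 : ℚ) < 4 := by linarith
  norm_cast at pos lt
  obtain ⟨r, hr⟩ := hc.even_one
  omega

lemma update_one (hc : IsEvenCF c k) (h₃ : 3 < cfValue c s k) :
    IsEvenCF (Function.update c 1 (c 1 + (-2 : ℤ))) k := by
  have h := abs_lt.1 (hc.abs_sub_lt_one s)
  have lt : (2 : ℚ) < c 1 := by linarith
  norm_cast at lt
  refine ⟨hc.1, fun i hi => ?_, by rw [Function.update_self]; omega, fun i hi => ?_⟩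
  · obtain rfl | hi' := eq_or_ne i 1
    · rw [Function.update_self]
      exact hc.even_one.add (by decide)
    · rw [Function.update_of_ne hi']
      exact hc.2.1 i hi
  · rw [Function.update_of_ne (by rw [Finset.mem_Icc] at hi; omega)]
    exact hc.2.2.2 i hi

end IsEvenCF

end ContinuedFractions

/-! ### Descent along the continued fraction -/

/-- The effect of a lifting on the ratio of the length of a cycle to the number of its squares in
the corner sections. -/
def Lifting.ratio : Lifting → ℚ → ℚ
  | f, r => r + 2
  | g, r => 2 - 1 / (2 - 1 / r)
  | h, r => 2 + 1 / (2 - 1 / r)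

section Descent

variable {L : Lifting} {m n p q k x y : ℕ} {c : ℕ → ℤ} {s : ℕ → ℤˣ}

lemma Lifting.ratio_counts (L : Lifting) (hx : 0 < x) :
    L.ratio ((x + y : ℕ) / x) =
      ((L.counts (x, y)).1 + (L.counts (x, y)).2 : ℕ) / (L.counts (x, y)).1 := by
  have : (0 : ℚ) < x := by exact_mod_cast hx
  have sub_inv : 2 - 1 / (((x + y : ℕ) : ℚ) / x) = (x + 2 * y) / (x + y) := by
    push_cast
    field_simp
    ring
  cases L <;> simp only [ratio, counts, sub_inv] <;> push_cast <;> field_simp <;> ring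

lemma Lifting.counts_fst_pos (L : Lifting) (hx : 0 < x) : 0 < (L.counts (x, y)).1 := by
  cases L <;> simp only [counts] <;> omega

lemma Lifting.coprime_counts (L : Lifting) (h : x.Coprime y) :
    (L.counts (x, y)).1.Coprime (L.counts (x, y)).2 := by
  cases L <;> simp only [counts]
  · simpa using h
  · simpa using h
  · rw [← Nat.isCoprime_iff_coprime] at h ⊢
    have snd_eq : ((2 * x + 3 * y : ℕ) : ℤ) = -y + (x + 2 * y : ℕ) * 2 := by
      push_cast
      ring
    rw [snd_eq, IsCoprime.add_mul_left_right_iff, IsCoprime.neg_right_iff]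
    push_cast
    exact IsCoprime.add_mul_right_left_iff.2 h

namespace IsEvenCF

lemma one_eq_two_of_carries (hc : IsEvenCF c k) (hL : L.Carries m n p q) (hf : L ≠ .f)
    (hcf : (q : ℚ) / p = cfValue c s k) : c 1 = 2 := by
  have hmn := hL.lt_base
  have hp : (0 : ℚ) < p := by
    norm_cast
    cases L <;> obtain ⟨-, rfl, -⟩ := hL <;> first | exact absurd rfl hf | omega
  apply hc.one_eq_two (s := s) <;> rw [← hcf]
  · rw [one_lt_div hp]
    exact_mod_cast hL.lt
  · rw [div_lt_iff₀ hp]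
    norm_cast
    cases L <;> obtain ⟨-, rfl, hq⟩ := hL <;> first | exact absurd rfl hf | omega

lemma tail_of_eq_two (hc : IsEvenCF c (k + 1)) (hk : 1 ≤ k) (hc₁ : c 1 = 2) (hn : 0 < n) {e : ℤˣ}
    (hcf : 2 + ((e : ℤ) : ℚ) * (m / n) = cfValue c s (k + 1)) :
    s 1 = e ∧ 0 < m ∧ (n : ℚ) / m = cfValue (fun j => c (j + 1)) (fun j => s (j + 1)) k := by
  have one_lt := hc.one_lt_cfValue_tail hk fun j => s (j + 1)
  rw [cfValue_succ c s hk, hc₁, Int.cast_ofNat, add_right_inj] at hcf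
  set v := cfValue (fun j => c (j + 1)) (fun j => s (j + 1)) k
  have inv_pos : 0 < 1 / v := by positivity
  have nonneg : (0 : ℚ) ≤ m / n := by positivity
  obtain ⟨hs, inv_eq⟩ : s 1 = e ∧ 1 / v = m / n := by
    rcases Int.units_eq_one_or (s 1) with hs | hs <;>
      rcases Int.units_eq_one_or e with rfl | rfl <;>
      rw [hs] at hcf ⊢ <;> push_cast [neg_div] at hcf <;>
      first | exact ⟨rfl, by linarith⟩ | linarith
  have hn' : (0 : ℚ) < n := by exact_mod_cast hn
  refine ⟨hs, ?_, by rw [← one_div_one_div v, inv_eq, one_div_div]⟩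
  rw [inv_eq, div_pos_iff_of_pos_right hn'] at inv_pos
  exact_mod_cast inv_pos

lemma tail_of_carries (hc : IsEvenCF c (k + 1)) (hk : 1 ≤ k) (hL : L.Carries m n p q)
    (hf : L ≠ .f) (hcf : (q : ℚ) / p = cfValue c s (k + 1)) :
    0 < m ∧ (n : ℚ) / m = cfValue (fun j => c (j + 1)) (fun j => s (j + 1)) k ∧
      ∀ i ≥ 1, lengthRatio c s (i + 1) =
        L.ratio (lengthRatio (fun j => c (j + 1)) (fun j => s (j + 1)) i) := by
  have hc₁ := hc.one_eq_two_of_carries hL hf hcf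
  have hn : 0 < n := (Nat.zero_le m).trans_lt hL.lt_base
  suffices ∃ e : ℤˣ, (q : ℚ) / p = 2 + ((e : ℤ) : ℚ) * (m / n) ∧
      ∀ r, L.ratio r = 2 + ((e : ℤ) : ℚ) / (2 - 1 / r) by
    obtain ⟨e, quotient_eq, ratio_eq⟩ := this
    obtain ⟨hs, hm, hv⟩ := hc.tail_of_eq_two hk hc₁ hn (quotient_eq ▸ hcf)
    refine ⟨hm, hv, fun i hi => ?_⟩
    rw [lengthRatio_succ c s hi, hc₁, hs, ratio_eq, Int.cast_ofNat]
  have hn' : (n : ℚ) ≠ 0 := by exact_mod_cast hn.ne'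
  cases L with
  | f => exact absurd rfl hf
  | g =>
    obtain ⟨-, rfl, hq⟩ := hL
    have hq' : (q : ℚ) = 2 * p - m := eq_sub_of_add_eq (by exact_mod_cast hq)
    refine ⟨-1, ?_, fun r => ?_⟩
    · rw [hq']
      push_cast
      field_simp
      ring
    · push_cast [Lifting.ratio]
      ring
  | h =>
    obtain ⟨-, rfl, rfl⟩ := hL
    refine ⟨1, ?_, fun r => by push_cast [Lifting.ratio]; rfl⟩
    push_cast
    field_simp
    ring

lemma base_eq_zero (hc : IsEvenCF c 1) (hL : L.Carries m n p q) (hf : L ≠ .f)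
    (hcf : (q : ℚ) / p = cfValue c s 1) : m = 0 := by
  have hn : 0 < n := (Nat.zero_le m).trans_lt hL.lt_base
  have hp : p = n := by cases L <;> first | exact absurd rfl hf | exact hL.2.1
  have hpq : q = 2 * p := by
    have hc₁ := hc.one_eq_two_of_carries hL hf hcf
    rw [cfValue_one, hc₁, div_eq_iff (by rw [hp]; positivity)] at hcf
    exact_mod_cast hcf
  cases L <;> obtain ⟨-, -, hq⟩ := hL <;> first | exact absurd rfl hf | omega

lemma of_carries_f (hc : IsEvenCF c k) (hL : Lifting.f.Carries m n p q) (hm : 0 < m)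
    (hcf : (q : ℚ) / p = cfValue c s k) :
    ∃ c', IsEvenCF c' k ∧ (n : ℚ) / m = cfValue c' s k ∧
      ∀ i ≥ 1, lengthRatio c s i = Lifting.f.ratio (lengthRatio c' s i) := by
  obtain ⟨hmn, rfl, rfl⟩ := hL
  have one_lt : 1 < (n : ℚ) / p := (one_lt_div (by exact_mod_cast hm)).2 (by exact_mod_cast hmn)
  have hv : cfValue c s k = n / p + 2 := by
    rw [← hcf]
    push_cast
    field_simp
    ring
  refine ⟨_, hc.update_one (s := s) (by linarith), ?_, fun i hi => ?_⟩
  · rw [cfValue_update_one c s _ hc.1, hv]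
    simp
  · rw [lengthRatio_update_one c s _ hi, Lifting.ratio]
    simp

/-- A lifting prepends a step to the continued fraction, except that the octagons arise from the
empty frame `m = 0` when the continued fraction is `[2]`. -/
lemma descend (hc : IsEvenCF c k) (hL : L.Carries m n p q) (hp : 0 < p)
    (hcf : (q : ℚ) / p = cfValue c s k) :
    L ≠ .f ∧ k = 1 ∧ m = 0 ∨ ∃ c' s' k', k = k' + L.rise ∧ 0 < m ∧ IsEvenCF c' k' ∧
      (n : ℚ) / m = cfValue c' s' k' ∧
        ∀ i ≥ 1, lengthRatio c s (i + L.rise) = L.ratio (lengthRatio c' s' i) := by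
  by_cases hf : L = .f
  · subst hf
    have hm : 0 < m := hL.2.1 ▸ hp
    obtain ⟨c', h⟩ := hc.of_carries_f hL hm hcf
    exact .inr ⟨c', s, k, rfl, hm, h⟩
  · obtain ⟨k, rfl⟩ : ∃ j, k = j + 1 := ⟨k - 1, (Nat.sub_add_cancel hc.1).symm⟩
    obtain rfl | hk := k.eq_zero_or_pos
    · exact .inl ⟨hf, rfl, hc.base_eq_zero hL hf hcf⟩
    · obtain ⟨hm, hv, h⟩ := hc.tail_of_carries hk hL hf hcf
      have hrise : L.rise = 1 := if_neg hf
      exact .inr ⟨_, _, k, by rw [hrise], hm, hc.tail hk, hv, by rwa [hrise]⟩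

end IsEvenCF

end Descent

/-! ### Classification of cycles -/

section Classification

variable {p q i j k : ℕ} {c : ℕ → ℤ} {s : ℕ → ℤˣ} {S : Set (ℤ × ℤ)}

@[elab_as_elim]
lemma lifting_induction {P : ∀ p q, 0 < p → p < q → Odd (p + q) → Prop}
    (step : ∀ L m n p q (hL : Lifting.Carries L m n p q) hp hodd,
      (∀ hm : 0 < m, P m n hm hL.lt_base (hL.odd_iff.1 hodd)) → P p q hp hL.lt hodd)
    (hp : 0 < p) (hpq : p < q) (hodd : Odd (p + q)) : P p q hp hpq hodd := by
  induction q using Nat.strong_induction_on generalizing p with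
  | _ q ih =>
    obtain ⟨L, m, n, hL⟩ := exists_carries hp hpq hodd
    have hnq : n < q := by cases L <;> obtain ⟨hmn, rfl, hq⟩ := hL <;> omega
    exact step L m n p q hL hp hodd fun hm => ih n hnq hm hL.lt_base (hL.odd_iff.1 hodd)

theorem HasType.unique (hodd : Odd (p + q)) (hi : HasType p q i S) (hj : HasType p q j S) :
    i = j := by
  obtain ⟨hp, hpq⟩ := hi.pos_and_lt
  induction hp, hpq, hodd using lifting_induction generalizing i j S with
  | step L m n p q hL _ hodd ih =>
    have hodd' := hL.odd_iff.1 hodd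
    have cycle_ne_octagon {l T u} (hT : HasType m n l T) (hu : u ∈ frameSection m n 0) :
        liftTo p q T ≠ liftTo p q {u} := fun h =>
      (hT.isCycleSet hodd').not_subset_hole hL.lt_base hodd' <|
        (hL.subset_of_liftTo_subset ((hT.isCycleSet hodd').subset_frame hL.lt_base hodd')
          h.subset).trans (Set.singleton_subset_iff.2 hu)
    rcases (hasType_iff hL hodd).1 hi with ⟨l, T, rfl, hT, rfl⟩ | ⟨-, rfl, u, hu, rfl⟩ <;>
      rcases (hasType_iff hL hodd).1 hj with ⟨l', T', rfl, hT', h⟩ | ⟨-, rfl, u', hu', h⟩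
    · have hTT' : T = T' :=
        (hL.subset_of_liftTo_subset ((hT.isCycleSet hodd').subset_frame hL.lt_base hodd')
          h.subset).antisymm
        (hL.subset_of_liftTo_subset ((hT'.isCycleSet hodd').subset_frame hL.lt_base hodd')
          h.symm.subset)
      rw [ih hT.pos_and_lt.1 hT (hTT' ▸ hT')]
    · exact absurd h (cycle_ne_octagon hT hu')
    · exact absurd h.symm (cycle_ne_octagon hT' hu)
    · rfl

theorem IsCycleSet.exists_hasType (hp : 0 < p) (hpq : p < q) (hodd : Odd (p + q))
    (hS : IsCycleSet p q S) : ∃ i, HasType p q i S := by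
  induction hp, hpq, hodd using lifting_induction generalizing S with
  | step L m n p q hL _ hodd ih =>
    obtain ⟨T, hT, rfl⟩ | h := (hL.isCycleSet_iff hodd).1 hS
    · have hodd' := hL.odd_iff.1 hodd
      obtain ⟨t, ht⟩ := hT.nonempty hL.lt_base hodd'
      have hm := pos_of_mem_frame (hT.subset_frame hL.lt_base hodd' ht)
      obtain ⟨i, hi⟩ := ih hm hT
      exact ⟨_, hi.lift hL⟩
    · exact ⟨1, (hasType_iff hL hodd).2 (.inr ⟨h.1, rfl, h.2⟩)⟩

theorem HasType.exists_counts (hodd : Odd (p + q)) (hS : HasType p q i S) (hc : IsEvenCF c k)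
    (hcf : (q : ℚ) / p = cfValue c s k) : i ≤ k ∧ ∃ x y, 0 < x ∧ x.Coprime y ∧
      HasCounts p q S x y ∧ lengthRatio c s i = (x + y : ℕ) / x := by
  obtain ⟨hp, hpq⟩ := hS.pos_and_lt
  induction hp, hpq, hodd using lifting_induction generalizing i k c s S with
  | step L m n p q hL hp hodd ih =>
    rcases (hasType_iff hL hodd).1 hS with ⟨j, T, rfl, hT, rfl⟩ | ⟨hf, rfl, u, hu, rfl⟩
    · obtain ⟨hm, hmn⟩ := hT.pos_and_lt
      have hodd' := hL.odd_iff.1 hodd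
      obtain ⟨-, -, rfl⟩ | ⟨c', s', k', rfl, -, hc', hcf', hratio⟩ := hc.descend hL hp hcf
      · exact absurd hm (lt_irrefl 0)
      · obtain ⟨hjk, x, y, hx, hxy, hcounts, hj⟩ := ih hm hT hc' hcf'
        refine ⟨Nat.add_le_add_right hjk _, _, _, L.counts_fst_pos hx, L.coprime_counts hxy,
          hL.hasCounts_liftTo hodd ((hT.isCycleSet hodd').subset_frame hmn hodd') hcounts, ?_⟩
        rw [hratio j hT.one_le, hj, L.ratio_counts hx]
    · refine ⟨hc.1, 1, 1, one_pos, Nat.coprime_one_left 1,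
        hL.hasCounts_liftTo_singleton hodd hf hu, ?_⟩
      rw [lengthRatio_one, hc.one_eq_two_of_carries hL hf hcf]
      norm_num

lemma zero_mem_hole (hpq : p < q) : 0 ∈ frameSection p q 0 := by
  have mid : InBand p q 0 0 := by
    change |2 * 0| < (q : ℤ) - p
    simpa using hpq
  exact ⟨mid, mid⟩

theorem exists_hasType (hp : 0 < p) (hpq : p < q) (hodd : Odd (p + q)) (hc : IsEvenCF c k)
    (hcf : (q : ℚ) / p = cfValue c s k) (hi : i ∈ Finset.Icc 1 k) : ∃ S, HasType p q i S := by
  induction hp, hpq, hodd using lifting_induction generalizing i k c s with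
  | step L m n p q hL hp hodd ih =>
    rw [Finset.mem_Icc] at hi
    by_cases h : L ≠ .f ∧ i = 1
    · exact ⟨_, (hasType_iff hL hodd).2 (.inr ⟨h.1, h.2, 0, zero_mem_hole hL.lt_base, rfl⟩)⟩
    · obtain ⟨hf, rfl, -⟩ | ⟨c', s', k', rfl, hm, hc', hcf', -⟩ := hc.descend hL hp hcf
      · exact absurd ⟨hf, by omega⟩ h
      · obtain ⟨j, hj, rfl⟩ : ∃ j, 1 ≤ j ∧ i = j + L.rise := by
          refine ⟨i - L.rise, ?_⟩
          rw [Lifting.rise]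
          split_ifs with hf
          · exact ⟨hi.1, rfl⟩
          · have : i ≠ 1 := fun hi => h ⟨hf, hi⟩
            omega
        obtain ⟨T, hT⟩ := ih hm hc' hcf' (Finset.mem_Icc.2 ⟨hj, by omega⟩)
        exact ⟨_, hT.lift hL⟩

end Classification

end Leaper

theorem mainTheorem3_general (p q : ℕ) (hp : 0 < p) (hpq : p < q) (hodd : Odd (p + q))
    (k : ℕ) (c : ℕ → ℤ) (s : ℕ → ℤˣ) (hc : Leaper.IsEvenCF c k)
    (hcf : (q : ℚ) / (p : ℚ) = Leaper.cfValue c s k) :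
    (∀ (a : Leaper.board (p + q)) (C : (Leaper.leaperGraph p q).Walk a a), C.IsCycle →
      ∃! i : ℕ, i ∈ Finset.Icc 1 k ∧ Leaper.HasType p q i (Leaper.squares C)) ∧
    (∀ i ∈ Finset.Icc 1 k,
      ∃ (a : Leaper.board (p + q)) (C : (Leaper.leaperGraph p q).Walk a a),
        C.IsCycle ∧ Leaper.HasType p q i (Leaper.squares C)) ∧
    (∀ i ∈ Finset.Icc 1 k,
      ∀ (a : Leaper.board (p + q)) (C : (Leaper.leaperGraph p q).Walk a a), C.IsCycle →
        Leaper.HasType p q i (Leaper.squares C) →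
          (C.length : ℤ) = 4 * (Leaper.lengthRatio c s i).num) := by
  refine ⟨fun a C hC => ?_, fun i hi => ?_, fun i _ a C hC hi => ?_⟩
  · have hS : Leaper.IsCycleSet p q (Leaper.squares C) := ⟨a, C, hC, rfl⟩
    obtain ⟨i, hi⟩ := hS.exists_hasType hp hpq hodd
    have hik := (hi.exists_counts hodd hc hcf).1
    exact ⟨i, ⟨Finset.mem_Icc.2 ⟨hi.one_le, hik⟩, hi⟩, fun j hj => hj.2.unique hodd hi⟩
  · obtain ⟨S, hS⟩ := Leaper.exists_hasType hp hpq hodd hc hcf hi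
    obtain ⟨a, C, hC, rfl⟩ := hS.isCycleSet hodd
    exact ⟨a, C, hC, hS⟩
  · obtain ⟨-, x, y, hx, hxy, hcounts, hratio⟩ := hi.exists_counts hodd hc hcf
    have num_eq : (Leaper.lengthRatio c s i).num = (x + y : ℕ) := by
      rw [hratio]
      exact Rat.num_div_eq_of_coprime (a := (x + y : ℕ)) (b := x) (by exact_mod_cast hx)
        (Nat.coprime_self_add_left.2 hxy.symm)
    have ncard_eq := hcounts.ncard_eq hpq hodd ((hi.isCycleSet hodd).subset_frame hpq hodd)
    rw [Leaper.length_eq_ncard_squares hC, ncard_eq, num_eq]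
    push_cast
    ring

theorem mainTheorem3 (p q : ℕ) (hp : 0 < p) (hpq : p < q) (hcop : Nat.Coprime p q)
    (hodd : Odd (p + q)) (k : ℕ) (c : ℕ → ℤ) (s : ℕ → ℤˣ) (hc : Leaper.IsEvenCF c k)
    (hcf : (q : ℚ) / (p : ℚ) = Leaper.cfValue c s k) :
    (∀ (a : Leaper.board (p + q)) (C : (Leaper.leaperGraph p q).Walk a a), C.IsCycle →
      ∃! i : ℕ, i ∈ Finset.Icc 1 k ∧ Leaper.HasType p q i (Leaper.squares C)) ∧
    (∀ i ∈ Finset.Icc 1 k,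
      ∃ (a : Leaper.board (p + q)) (C : (Leaper.leaperGraph p q).Walk a a),
        C.IsCycle ∧ Leaper.HasType p q i (Leaper.squares C)) ∧
    (∀ i ∈ Finset.Icc 1 k,
      ∀ (a : Leaper.board (p + q)) (C : (Leaper.leaperGraph p q).Walk a a), C.IsCycle →
        Leaper.HasType p q i (Leaper.squares C) →
          (C.length : ℤ) = 4 * (Leaper.lengthRatio c s i).num) :=
  mainTheorem3_general p q hp hpq hodd k c s hc hcf
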